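/- **Setting.** A leader $A$ and a follower $B$ take part in a sealed-bid first-price auction for one item. The leader's valuation has a density $f_1\ge 0$ with support $[a_1,a_2]$, $0\le a_1<a_2$, and distribution function $F_1(x)=\int_{a_1}^x f_1$. The follower's valuation is independent and uniform on $[b_1,b_2]$, $0\le b_1<b_2$, with distribution function $F_2$. The leader commits to a (possibly randomized, measurable) strategy $s$, assigning to each valuation $x$ a law of bids. Let $P_B[t]$ be the probability that his bid is at most $t$ (ties go to the follower). The follower with valuation $y$ submits the lowest bid $t\ge 0$ attaining $u_B(y)=\sup_{t\ge 0}(y-t)P_B[t]$. The leader wins, and pays his bid, iff it exceeds the follower's bid. A strategy is an *optimal commitment* if it maximizes the leader's expected utility. The *equal-bid function* of $s$ is defined for $x\in(a_1,a_2]$ by $$g(x)=\min\Big\{y\in[0,b_2] : y-\frac{u_B(y)}{F_1(x)}=s^*(x)\Big\},\qquad s^*(x)=\sup_{y\in[0,b_2]}\Big(y-\frac{u_B(y)}{F_1(x)}\Big).$$ A function $g:(a_1,a_2]\to\mathbb R$ is called *optimal* if it is the equal-bid function of an optimal commitment. **Theorem.** An optimal $g$ exists. A function $g$ is optimal if and only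 if it maximizes $$\int_{a_1}^{a_2}\Big(x-\frac{1}{F_1(x)}\int_{a_1}^x f_1(t)g(t)\,dt\Big)F_2(g(x))f_1(x)\,dx$$ among all weakly increasing, left-continuous functions $g:(a_1,a_2]\to[0,b_2]$. Moreover: (1) If $f_1$ is differentiable on $(a_1,a_2)$ and $2f_1(t)^2-F_1(t)f_1'(t)\ge 0$ for all $t\in(a_1,a_2)$, then every optimal $g$ takes at most $3$ values on $(a_1,a_2]$. (2) Suppose $b_1=0$ and let $g$ be optimal. If $t_0\in(a_1,a_2)$ satisfies $$t_0=b_2\int_{t_0}^{a_2}\frac{f_1(t)}{F_1(t)}\,dt,$$ then $g(x)=0$ for $x\in(a_1,t_0]$ and $g(x)=b_2$ for $x\in(t_0,a_2]$. If there is no such $t_0$, then $g(x)=b_2$ for all $x\in(a_1,a_2]$. -/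

import Mathlib

open MeasureTheory ProbabilityTheory Set

/-- A sealed-bid first-price auction with a leader `A` and a follower `B`. The leader's valuation has
density `f₁` and support `[a₁, a₂]`; the follower's valuation is uniform on `[b₁, b₂]`. -/
structure FirstPriceAuction where
  a₁ : ℝ
  a₂ : ℝ
  b₁ : ℝ
  b₂ : ℝ
  f₁ : ℝ → ℝ
  a₁_nonneg : 0 ≤ a₁
  a₁_lt_a₂ : a₁ < a₂
  b₁_nonneg : 0 ≤ b₁
  b₁_lt_b₂ : b₁ < b₂
  f₁_nonneg : ∀ x ∈ Icc a₁ a₂, 0 ≤ f₁ x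
  f₁_integrable : IntervalIntegrable f₁ volume a₁ a₂
  integral_f₁ : ∫ x in a₁..a₂, f₁ x = 1
  /-- the support is all of `[a₁, a₂]`: every nondegenerate subinterval has positive mass -/
  f₁_support : ∀ c d : ℝ, a₁ ≤ c → c < d → d ≤ a₂ → 0 < ∫ x in c..d, f₁ x

namespace FirstPriceAuction

/-- The distribution function of the leader's valuation, on `[a₁, a₂]`. -/
noncomputable def F₁ (A : FirstPriceAuction) (x : ℝ) : ℝ :=
  ∫ t in A.a₁..x, A.f₁ t

/-- The law of the leader's valuation. -/
noncomputable def leaderLaw (A : FirstPriceAuction) : Measure ℝ :=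
  (volume.restrict (Icc A.a₁ A.a₂)).withDensity (fun x => ENNReal.ofReal (A.f₁ x))

/-- The law of the follower's valuation: the uniform distribution on `[b₁, b₂]`. -/
noncomputable def followerLaw (A : FirstPriceAuction) : Measure ℝ :=
  ProbabilityTheory.cond volume (Icc A.b₁ A.b₂)

/-- The distribution function of the follower's valuation. -/
noncomputable def F₂ (A : FirstPriceAuction) (y : ℝ) : ℝ :=
  cdf A.followerLaw y

/-! ### The game

A strategy of the leader is a Markov kernel `s`: at valuation `x` his bid has law `s x`. -/

/-- The law of the leader's bid under the strategy `s`. -/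
noncomputable def bidLaw (A : FirstPriceAuction) (s : Kernel ℝ ℝ) : Measure ℝ :=
  A.leaderLaw.bind s

/-- The follower's winning probability with the bid `t`; the follower wins ties. -/
noncomputable def winProbB (A : FirstPriceAuction) (s : Kernel ℝ ℝ) (t : ℝ) : ℝ :=
  (A.bidLaw s).real (Iic t)

/-- The expected payoff of the follower with valuation `y` and bid `t`. -/
noncomputable def followerPayoff (A : FirstPriceAuction) (s : Kernel ℝ ℝ) (y t : ℝ) : ℝ :=
  (y - t) * A.winProbB s t

/-- `u_B(y)`: the largest payoff of the follower with valuation `y`, over bids `t ≥ 0`. -/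
noncomputable def followerUtility (A : FirstPriceAuction) (s : Kernel ℝ ℝ) (y : ℝ) : ℝ :=
  sSup (A.followerPayoff s y '' Ici 0)

/-- The best responses of the follower with valuation `y`. -/
def bestResponses (A : FirstPriceAuction) (s : Kernel ℝ ℝ) (y : ℝ) : Set ℝ :=
  {t | 0 ≤ t ∧ ∀ t', 0 ≤ t' → A.followerPayoff s y t' ≤ A.followerPayoff s y t}

/-- The follower submits her lowest best response. -/
noncomputable def followerBid (A : FirstPriceAuction) (s : Kernel ℝ ℝ) (y : ℝ) : ℝ :=
  sInf (A.bestResponses s y)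

open Classical in
/-- The realized payoff of the leader at `p = ((x, b), y)`: valuation `x`, bid `b`, and follower's
valuation `y`. He wins, and pays `b`, exactly if `b` exceeds the follower's bid. -/
noncomputable def leaderPayoff (A : FirstPriceAuction) (s : Kernel ℝ ℝ) (p : (ℝ × ℝ) × ℝ) : ℝ :=
  if A.followerBid s p.2 < p.1.2 then p.1.1 - p.1.2 else 0

/-- The joint law of (leader's valuation, leader's bid) and the independent follower's valuation. -/
noncomputable def outcomeLaw (A : FirstPriceAuction) (s : Kernel ℝ ℝ) : Measure ((ℝ × ℝ) × ℝ) :=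
  (A.leaderLaw.compProd s).prod A.followerLaw

/-- `u_A(s)`: the expected utility of the leader committing to `s`. -/
noncomputable def leaderUtility (A : FirstPriceAuction) (s : Kernel ℝ ℝ) : ℝ :=
  ∫ p, A.leaderPayoff s p ∂(A.outcomeLaw s)

/-- Strategies of finite expected payoff. (The payoff is at most `a₂`, so that a strategy whose
payoff is not integrable has expected utility `-∞` and is never optimal.) -/
def IsStrategy (A : FirstPriceAuction) (s : Kernel ℝ ℝ) : Prop :=
  IsMarkovKernel s ∧ Integrable (A.leaderPayoff s) (A.outcomeLaw s)

/-- `s` is an optimal commitment of the leader. -/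
def IsOptimalCommitment (A : FirstPriceAuction) (s : Kernel ℝ ℝ) : Prop :=
  A.IsStrategy s ∧ ∀ s' : Kernel ℝ ℝ, A.IsStrategy s' → A.leaderUtility s' ≤ A.leaderUtility s

/-! ### The equal-bid function -/

/-- The equal-utility curve `eu_B(y, ·)`: the unique `t` with `u_B(y) = F₁(x) y - t F₁(x)`, for
`x ∈ (a₁, a₂]`. -/
noncomputable def equalUtilityCurve (A : FirstPriceAuction) (s : Kernel ℝ ℝ) (y x : ℝ) : ℝ :=
  y - A.followerUtility s y / A.F₁ x

/-- The smoothed strategy `s*`: the supremum of the equal-utility curves over `y ∈ [0, b₂]`. -/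
noncomputable def smoothed (A : FirstPriceAuction) (s : Kernel ℝ ℝ) (x : ℝ) : ℝ :=
  sSup ((fun y => A.equalUtilityCurve s y x) '' Icc 0 A.b₂)

/-- The equal-bid function of `s` on `(a₁, a₂]`: the smallest `y ∈ [0, b₂]` whose equal-utility
curve passes through the point `(x, s*(x))`. -/
noncomputable def equalBid (A : FirstPriceAuction) (s : Kernel ℝ ℝ) (x : ℝ) : ℝ :=
  sInf {y | y ∈ Icc 0 A.b₂ ∧ A.equalUtilityCurve s y x = A.smoothed s x}

/-- `g` is, on `(a₁, a₂]`, the equal-bid function of an optimal commitment. -/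
def IsOptimalEqualBid (A : FirstPriceAuction) (g : ℝ → ℝ) : Prop :=
  ∃ s : Kernel ℝ ℝ, A.IsOptimalCommitment s ∧ ∀ x ∈ Ioc A.a₁ A.a₂, g x = A.equalBid s x

/-! ### The optimization problem for `g` -/

/-- Weakly increasing, left-continuous functions from `(a₁, a₂]` to `[0, b₂]`. -/
def IsAdmissible (A : FirstPriceAuction) (g : ℝ → ℝ) : Prop :=
  MonotoneOn g (Ioc A.a₁ A.a₂) ∧
  (∀ x ∈ Ioc A.a₁ A.a₂, ContinuousWithinAt g (Iic x) x) ∧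
  ∀ x ∈ Ioc A.a₁ A.a₂, g x ∈ Icc 0 A.b₂

/-- The bid `(1 / F₁(x)) ∫_{a₁}^x f₁ g` of the leader at `x ∈ (a₁, a₂]`. -/
noncomputable def bidOf (A : FirstPriceAuction) (g : ℝ → ℝ) (x : ℝ) : ℝ :=
  (∫ t in A.a₁..x, A.f₁ t * g t) / A.F₁ x

/-- The leader's utility in terms of `g`. -/
noncomputable def objective (A : FirstPriceAuction) (g : ℝ → ℝ) : ℝ :=
  ∫ x in A.a₁..A.a₂, (x - A.bidOf g x) * A.F₂ (g x) * A.f₁ x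

/-- `g` maximizes the objective among the admissible functions. -/
def IsMaximizer (A : FirstPriceAuction) (g : ℝ → ℝ) : Prop :=
  A.IsAdmissible g ∧ ∀ g' : ℝ → ℝ, A.IsAdmissible g' → A.objective g' ≤ A.objective g

end FirstPriceAuction

namespace FirstPriceAuction

open Filter Topology

section Laws

variable (A : FirstPriceAuction)

/-! ### The laws of the valuations -/

/-! Reduction to `g`. For a commitment `s`, `u_B` is a supremum of affine functions of `y` whose
slopes are winning probabilities. Thus `F₁ x * s*(x) = max_y (F₁ x * y - u_B y)` is a Legendre
transform of `u_B` at the slope `F₁ x`, and the equal-bid function is its smallest maximizer. It is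
therefore increasing and left-continuous (`isAdmissible_equalBid`), and the envelope theorem
`cumul_equalBid` says that `s*` is `bidOf` of it. Fix a follower who bids `t`. The payoff attached
to the equal-bid function wins against her with the same probability as `s`, but with the highest
valuations (`setIntegral_fst_le`) and with stochastically smaller payments (`le_setIntegral_snd`).
So the utility of `s` is at most the objective of its equal-bid function. Conversely, bidding `bidOf
g` deterministically has equal-bid function `g` and utility `objective g`. This proves
`isOptimalEqualBid_iff`; a maximizer exists by Helly selection and dominated convergence.

Structure of the maximizers. Where `b₁ ≤ g`, `F₂` is affine, so between two such functions the
objective is quadratic and its gradient is a positive multiple of `marginal g`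
(`IsMaximizer.eq_of_marginal`). Formally the marginal has derivative `1 + D * f₁ / F₁ ^ 2` with `D x
= ∫ f₁ (g - b₁)` over `(a₁, x]`; `IsAdmissible.marginal_sub` is the integrated form. Where `g > b₁`,
`D` increases. If `-1 / F₁` is concave, the marginal is strictly quasiconvex there, so it is
negative only on an interval; flattening `g` to one value up to the end of that interval and to `b₂`
beyond it does not lower the objective to first order. Values at most `b₁` never win and are
replaced by `0`, which leaves three values. If `b₁ = 0`, then `D ≥ 0`, the marginal is strictly
increasing, and `g` jumps once from `0` to `b₂`, at the zero of the marginal if there is one. -/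

lemma integrableOn_f₁ : IntegrableOn A.f₁ (Icc A.a₁ A.a₂) :=
  (intervalIntegrable_iff_integrableOn_Icc_of_le A.a₁_lt_a₂.le).1 A.f₁_integrable

instance isProbabilityMeasure_leaderLaw : IsProbabilityMeasure A.leaderLaw := by
  constructor
  rw [leaderLaw, withDensity_apply _ MeasurableSet.univ, Measure.restrict_univ,
    ← ofReal_integral_eq_lintegral_ofReal A.integrableOn_f₁, integral_Icc_eq_integral_Ioc,
    ← intervalIntegral.integral_of_le A.a₁_lt_a₂.le, A.integral_f₁, ENNReal.ofReal_one]
  exact (ae_restrict_mem measurableSet_Icc).mono A.f₁_nonneg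

instance nullSingletonClass_leaderLaw : NullSingletonClass A.leaderLaw := by
  unfold leaderLaw; infer_instance

lemma setIntegral_leaderLaw (h : ℝ → ℝ) {c d : ℝ} (hc : A.a₁ ≤ c) (hcd : c ≤ d) (hd : d ≤ A.a₂) :
    ∫ t in Ioc c d, h t ∂A.leaderLaw = ∫ t in c..d, A.f₁ t * h t := by
  have hsub : Ioc c d ⊆ Icc A.a₁ A.a₂ := fun x hx => ⟨hc.trans hx.1.le, hx.2.trans hd⟩
  rw [leaderLaw, setIntegral_withDensity_eq_setIntegral_toReal_smul₀, intervalIntegral.integral_of_le hcd,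
    Measure.restrict_restrict measurableSet_Ioc, inter_eq_left.2 hsub]
  · refine setIntegral_congr_fun measurableSet_Ioc fun x hx => ?_
    simp [ENNReal.toReal_ofReal (A.f₁_nonneg x (hsub hx))]
  · exact (A.integrableOn_f₁.aemeasurable.ennreal_ofReal).mono_measure Measure.restrict_le_self
  · exact Eventually.of_forall fun _ => ENNReal.ofReal_lt_top
  · exact measurableSet_Ioc

lemma ae_mem_Ioc : ∀ᵐ x ∂A.leaderLaw, x ∈ Ioc A.a₁ A.a₂ := by
  have h1 : ∀ᵐ x ∂A.leaderLaw, x ∈ Icc A.a₁ A.a₂ :=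
    (withDensity_absolutelyContinuous _ _).ae_le (ae_restrict_mem measurableSet_Icc)
  have h2 : ∀ᵐ x ∂A.leaderLaw, x ≠ A.a₁ := by
    simp [ae_iff]
  filter_upwards [h1, h2] with x hx hx' using ⟨lt_of_le_of_ne hx.1 hx'.symm, hx.2⟩

lemma restrict_leaderLaw : A.leaderLaw.restrict (Ioc A.a₁ A.a₂) = A.leaderLaw :=
  Measure.restrict_eq_self_of_ae_mem A.ae_mem_Ioc

lemma integral_leaderLaw (h : ℝ → ℝ) :
    ∫ t, h t ∂A.leaderLaw = ∫ t in A.a₁..A.a₂, A.f₁ t * h t := by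
  rw [← A.setIntegral_leaderLaw h le_rfl A.a₁_lt_a₂.le le_rfl, A.restrict_leaderLaw]

lemma intervalIntegrable_f₁ {c d : ℝ} (hc : c ∈ Icc A.a₁ A.a₂) (hd : d ∈ Icc A.a₁ A.a₂) :
    IntervalIntegrable A.f₁ volume c d :=
  A.f₁_integrable.mono_set (by
    rw [uIcc_of_le A.a₁_lt_a₂.le]; exact uIcc_subset_Icc hc hd)

lemma F₁_sub {c d : ℝ} (hc : c ∈ Icc A.a₁ A.a₂) (hd : d ∈ Icc A.a₁ A.a₂) :
    A.F₁ d - A.F₁ c = ∫ t in c..d, A.f₁ t := by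
  have ha : A.a₁ ∈ Icc A.a₁ A.a₂ := left_mem_Icc.2 A.a₁_lt_a₂.le
  exact intervalIntegral.integral_interval_sub_left (A.intervalIntegrable_f₁ ha hd)
    (A.intervalIntegrable_f₁ ha hc)

@[simp] lemma F₁_left : A.F₁ A.a₁ = 0 := by simp [F₁]

@[simp] lemma F₁_right : A.F₁ A.a₂ = 1 := A.integral_f₁

lemma F₁_strictMonoOn : StrictMonoOn A.F₁ (Icc A.a₁ A.a₂) := by
  intro c hc d hd hcd
  have := A.f₁_support c d hc.1 hcd hd.2
  rw [← A.F₁_sub hc hd] at this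
  linarith

lemma F₁_continuousOn : ContinuousOn A.F₁ (Icc A.a₁ A.a₂) := by
  have := intervalIntegral.continuousOn_primitive_interval (f := A.f₁) (μ := volume)
    (a := A.a₁) (b := A.a₂) (by rw [uIcc_of_le A.a₁_lt_a₂.le]; exact A.integrableOn_f₁)
  rwa [uIcc_of_le A.a₁_lt_a₂.le] at this

lemma F₁_pos {x : ℝ} (hx : x ∈ Ioc A.a₁ A.a₂) : 0 < A.F₁ x := by
  simpa using A.F₁_strictMonoOn (left_mem_Icc.2 A.a₁_lt_a₂.le) (Ioc_subset_Icc_self hx) hx.1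

lemma F₁_le_one {x : ℝ} (hx : x ∈ Icc A.a₁ A.a₂) : A.F₁ x ≤ 1 := by
  simpa using A.F₁_strictMonoOn.monotoneOn hx (right_mem_Icc.2 A.a₁_lt_a₂.le) hx.2

lemma exists_F₁_eq {q : ℝ} (hq : q ∈ Icc (0 : ℝ) 1) : ∃ x ∈ Icc A.a₁ A.a₂, A.F₁ x = q := by
  have := intermediate_value_Icc A.a₁_lt_a₂.le A.F₁_continuousOn
  rw [F₁_left, F₁_right] at this
  exact this hq

lemma leaderLaw_real_Ioc {c d : ℝ} (hc : A.a₁ ≤ c) (hcd : c ≤ d) (hd : d ≤ A.a₂) :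
    A.leaderLaw.real (Ioc c d) = A.F₁ d - A.F₁ c := by
  have := A.setIntegral_leaderLaw (fun _ => 1) hc hcd hd
  simp only [integral_const, smul_eq_mul, mul_one] at this
  rw [A.F₁_sub ⟨hc, hcd.trans hd⟩ ⟨hc.trans hcd, hd⟩, ← this]
  simp

lemma leaderLaw_real_Iic {x : ℝ} (hx : x ∈ Icc A.a₁ A.a₂) : A.leaderLaw.real (Iic x) = A.F₁ x := by
  rw [← sub_zero (A.F₁ x), ← A.F₁_left, ← A.leaderLaw_real_Ioc le_rfl hx.1 hx.2]
  refine measureReal_congr ?_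
  filter_upwards [A.ae_mem_Ioc] with t ht
  exact propext ⟨fun h => ⟨ht.1, h⟩, fun h => h.2⟩

lemma leaderLaw_real_Ioi {x : ℝ} (hx : x ∈ Icc A.a₁ A.a₂) :
    A.leaderLaw.real (Ioi x) = 1 - A.F₁ x := by
  rw [← A.leaderLaw_real_Iic hx, ← compl_Iic, probReal_compl_eq_one_sub measurableSet_Iic]

instance isProbabilityMeasure_followerLaw : IsProbabilityMeasure A.followerLaw :=
  cond_isProbabilityMeasure_of_finite (by simp [A.b₁_lt_b₂]) (by simp)

instance nullSingletonClass_followerLaw : NullSingletonClass A.followerLaw :=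
  ⟨fun x => (cond_absolutelyContinuous (μ := volume) (s := Icc A.b₁ A.b₂)) (by simp)⟩

lemma ae_mem_Icc_followerLaw : ∀ᵐ y ∂A.followerLaw, y ∈ Icc A.b₁ A.b₂ :=
  ae_cond_mem measurableSet_Icc

lemma b₂_pos : 0 < A.b₂ := A.b₁_nonneg.trans_lt A.b₁_lt_b₂

lemma F₂_eq_real_Iio (y : ℝ) : A.F₂ y = A.followerLaw.real (Iio y) := by
  rw [F₂, cdf_eq_real]
  exact measureReal_congr Iio_ae_eq_Iic.symm

lemma F₂_eq {y : ℝ} (hy : y ≤ A.b₂) : A.F₂ y = max 0 (y - A.b₁) / (A.b₂ - A.b₁) := by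
  have h : Icc A.b₁ A.b₂ ∩ Iic y = Icc A.b₁ y := by
    ext t; simp only [mem_inter_iff, mem_Icc, mem_Iic]
    exact ⟨fun h => ⟨h.1.1, h.2⟩, fun h => ⟨⟨h.1, h.2.trans hy⟩, h.2⟩⟩
  have hb := A.b₁_lt_b₂
  rw [F₂, cdf_eq_real, Measure.real, followerLaw, cond_apply measurableSet_Icc, h, Real.volume_Icc,
    Real.volume_Icc, ENNReal.toReal_mul, ENNReal.toReal_inv, ENNReal.toReal_ofReal (by linarith),
    ENNReal.toReal_ofReal', max_comm, div_eq_inv_mul]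

lemma F₂_nonneg (y : ℝ) : 0 ≤ A.F₂ y := cdf_nonneg _ _

lemma F₂_le_one (y : ℝ) : A.F₂ y ≤ 1 := cdf_le_one _ _

lemma F₂_mono : Monotone A.F₂ := monotone_cdf _

lemma F₂_continuousOn : ContinuousOn A.F₂ (Iic A.b₂) := by
  refine ContinuousOn.congr (f := fun y => max 0 (y - A.b₁) / (A.b₂ - A.b₁)) ?_ fun y hy => A.F₂_eq hy
  fun_prop

/-! ### Admissible functions -/

/-- The unnormalized bid `∫_{a₁}^x f₁ g`, as an integral against the law of the leader. -/
noncomputable def cumul (g : ℝ → ℝ) (x : ℝ) : ℝ :=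
  ∫ t in Ioc A.a₁ x, g t ∂A.leaderLaw

lemma bidOf_eq (g : ℝ → ℝ) {x : ℝ} (hx : x ∈ Ioc A.a₁ A.a₂) :
    A.bidOf g x = A.cumul g x / A.F₁ x := by
  rw [bidOf, cumul, A.setIntegral_leaderLaw g le_rfl hx.1.le hx.2]

lemma objective_eq (g : ℝ → ℝ) :
    A.objective g = ∫ x, (x - A.bidOf g x) * A.F₂ (g x) ∂A.leaderLaw := by
  rw [A.integral_leaderLaw, objective]
  simp only [mul_comm]

variable {A} {g : ℝ → ℝ}

lemma IsAdmissible.aemeasurable (hg : A.IsAdmissible g) : AEMeasurable g A.leaderLaw := by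
  have := aemeasurable_restrict_of_monotoneOn (μ := A.leaderLaw) measurableSet_Ioc hg.1
  rwa [A.restrict_leaderLaw] at this

lemma IsAdmissible.ae_mem (hg : A.IsAdmissible g) : ∀ᵐ x ∂A.leaderLaw, g x ∈ Icc 0 A.b₂ :=
  A.ae_mem_Ioc.mono hg.2.2

lemma integrable_of_ae_abs_le {h : ℝ → ℝ} (hm : AEMeasurable h A.leaderLaw) {C : ℝ}
    (hC : ∀ᵐ x ∂A.leaderLaw, |h x| ≤ C) : Integrable h A.leaderLaw :=
  Integrable.of_bound hm.aestronglyMeasurable C hC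

lemma IsAdmissible.integrable (hg : A.IsAdmissible g) : Integrable g A.leaderLaw :=
  integrable_of_ae_abs_le hg.aemeasurable (C := A.b₂) (hg.ae_mem.mono fun x hx => by
    rw [abs_of_nonneg hx.1]; exact hx.2)

lemma cumul_sub (hg : Integrable g A.leaderLaw) {c d : ℝ} (hc : A.a₁ ≤ c) (hcd : c ≤ d) :
    A.cumul g d - A.cumul g c = ∫ t in Ioc c d, g t ∂A.leaderLaw := by
  rw [cumul, cumul, ← Ioc_union_Ioc_eq_Ioc hc hcd, setIntegral_union
    (Set.disjoint_left.2 fun x h1 h2 => not_lt.2 h1.2 h2.1) measurableSet_Ioc hg.integrableOn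
    hg.integrableOn]
  ring

lemma setIntegral_Ioc_le {c d M : ℝ} (hc : A.a₁ ≤ c) (hcd : c ≤ d) (hd : d ≤ A.a₂)
    (hg : Integrable g A.leaderLaw) (h : ∀ t ∈ Ioc c d, g t ≤ M) :
    ∫ t in Ioc c d, g t ∂A.leaderLaw ≤ M * (A.F₁ d - A.F₁ c) := by
  have := setIntegral_mono_on (hg.integrableOn (s := Ioc c d)) (integrable_const M).integrableOn
    measurableSet_Ioc h
  rwa [setIntegral_const, A.leaderLaw_real_Ioc hc hcd hd, smul_eq_mul, mul_comm] at this

lemma le_setIntegral_Ioc {c d m : ℝ} (hc : A.a₁ ≤ c) (hcd : c ≤ d) (hd : d ≤ A.a₂)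
    (hg : Integrable g A.leaderLaw) (h : ∀ t ∈ Ioc c d, m ≤ g t) :
    m * (A.F₁ d - A.F₁ c) ≤ ∫ t in Ioc c d, g t ∂A.leaderLaw := by
  have := setIntegral_mono_on (integrable_const m).integrableOn (hg.integrableOn (s := Ioc c d))
    measurableSet_Ioc h
  rwa [setIntegral_const, A.leaderLaw_real_Ioc hc hcd hd, smul_eq_mul, mul_comm] at this

@[simp] lemma cumul_left : A.cumul g A.a₁ = 0 := by simp [cumul]

lemma abs_cumul_sub_le (hg : Integrable g A.leaderLaw) {C : ℝ}
    (hC : ∀ x ∈ Ioc A.a₁ A.a₂, |g x| ≤ C) {c d : ℝ} (hc : A.a₁ ≤ c) (hcd : c ≤ d) (hd : d ≤ A.a₂) :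
    |A.cumul g d - A.cumul g c| ≤ C * (A.F₁ d - A.F₁ c) := by
  have hsub : ∀ t ∈ Ioc c d, t ∈ Ioc A.a₁ A.a₂ := fun t ht => ⟨hc.trans_lt ht.1, ht.2.trans hd⟩
  rw [cumul_sub hg hc hcd, abs_le]
  constructor
  · have := le_setIntegral_Ioc hc hcd hd hg fun t ht => (abs_le.1 (hC t (hsub t ht))).1
    linarith
  · exact setIntegral_Ioc_le hc hcd hd hg fun t ht => (abs_le.1 (hC t (hsub t ht))).2

lemma abs_cumul_le (hg : Integrable g A.leaderLaw) {C : ℝ}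
    (hC : ∀ x ∈ Ioc A.a₁ A.a₂, |g x| ≤ C) {x : ℝ} (hx : x ∈ Icc A.a₁ A.a₂) :
    |A.cumul g x| ≤ C * A.F₁ x := by
  simpa using abs_cumul_sub_le hg hC le_rfl hx.1 hx.2

lemma abs_bidOf_le (hg : Integrable g A.leaderLaw) {C : ℝ}
    (hC : ∀ x ∈ Ioc A.a₁ A.a₂, |g x| ≤ C) {x : ℝ} (hx : x ∈ Ioc A.a₁ A.a₂) :
    |A.bidOf g x| ≤ C := by
  rw [A.bidOf_eq g hx, abs_div, abs_of_pos (A.F₁_pos hx), div_le_iff₀ (A.F₁_pos hx)]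
  exact abs_cumul_le hg hC (Ioc_subset_Icc_self hx)

lemma cumul_continuousOn (hg : Integrable g A.leaderLaw) :
    ContinuousOn (A.cumul g) (Icc A.a₁ A.a₂) := by
  have := intervalIntegral.continuousOn_primitive_interval (f := g) (μ := A.leaderLaw)
    (a := A.a₁) (b := A.a₂) hg.integrableOn
  rw [uIcc_of_le A.a₁_lt_a₂.le] at this
  exact this.congr fun x hx => (intervalIntegral.integral_of_le hx.1).symm

lemma bidOf_continuousOn (hg : Integrable g A.leaderLaw) :
    ContinuousOn (A.bidOf g) (Ioc A.a₁ A.a₂) :=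
  (((cumul_continuousOn hg).mono Ioc_subset_Icc_self).div
    (A.F₁_continuousOn.mono Ioc_subset_Icc_self) fun _ hx => (A.F₁_pos hx).ne').congr
    fun _ hx => A.bidOf_eq g hx

lemma aemeasurable_bidOf (hg : Integrable g A.leaderLaw) :
    AEMeasurable (A.bidOf g) A.leaderLaw := by
  have := (bidOf_continuousOn hg).aemeasurable (μ := A.leaderLaw) measurableSet_Ioc
  rwa [A.restrict_leaderLaw] at this

lemma IsAdmissible.abs_le (hg : A.IsAdmissible g) : ∀ x ∈ Ioc A.a₁ A.a₂, |g x| ≤ A.b₂ :=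
  fun x hx => by rw [abs_of_nonneg (hg.2.2 x hx).1]; exact (hg.2.2 x hx).2

/-- Left-continuity in the form used below: a strict lower bound on `g x` persists on an interval of
positive mass to the left of `x`. -/
lemma IsAdmissible.exists_lt (hg : A.IsAdmissible g) {x y : ℝ} (hx : x ∈ Ioc A.a₁ A.a₂)
    (hy : y < g x) : ∃ c, A.a₁ < c ∧ c < x ∧ ∀ t ∈ Icc c x, y < g t := by
  have h1 : ∀ᶠ t in 𝓝[<] x, y < g t :=
    ((hg.2.1 x hx).eventually (eventually_gt_nhds hy)).filter_mono (nhdsWithin_mono _ Iio_subset_Iic_self)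
  have h2 : ∀ᶠ t in 𝓝[<] x, t ∈ Ioo A.a₁ x := Ioo_mem_nhdsLT hx.1
  obtain ⟨c, hc, hc'⟩ := (h1.and h2).exists
  exact ⟨c, hc'.1, hc'.2, fun t ht => hc.trans_le
    (hg.1 ⟨hc'.1, hc'.2.le.trans hx.2⟩ ⟨hc'.1.trans_le ht.1, ht.2.trans hx.2⟩ ht.1)⟩

lemma IsAdmissible.cumul_sub_le (hg : A.IsAdmissible g) {c d : ℝ} (hc : A.a₁ ≤ c) (hcd : c ≤ d)
    (hd : d ∈ Ioc A.a₁ A.a₂) : A.cumul g d - A.cumul g c ≤ g d * (A.F₁ d - A.F₁ c) := by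
  rw [cumul_sub hg.integrable hc hcd]
  exact setIntegral_Ioc_le hc hcd hd.2 hg.integrable fun t ht =>
    hg.1 ⟨hc.trans_lt ht.1, ht.2.trans hd.2⟩ hd ht.2

lemma IsAdmissible.le_cumul_sub (hg : A.IsAdmissible g) {c d : ℝ} (hc : c ∈ Ioc A.a₁ A.a₂)
    (hcd : c ≤ d) (hd : d ≤ A.a₂) : g c * (A.F₁ d - A.F₁ c) ≤ A.cumul g d - A.cumul g c := by
  rw [cumul_sub hg.integrable hc.1.le hcd]
  exact le_setIntegral_Ioc hc.1.le hcd hd hg.integrable fun t ht =>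
    hg.1 hc ⟨hc.1.trans ht.1, ht.2.trans hd⟩ ht.1.le

lemma IsAdmissible.cumul_nonneg (hg : A.IsAdmissible g) {x : ℝ} (hx : x ≤ A.a₂) :
    0 ≤ A.cumul g x :=
  setIntegral_nonneg measurableSet_Ioc fun t ht => (hg.2.2 t ⟨ht.1, ht.2.trans hx⟩).1

lemma IsAdmissible.F₁_mul_bidOf {x : ℝ} (hx : x ∈ Ioc A.a₁ A.a₂) :
    A.F₁ x * A.bidOf g x = A.cumul g x := by
  rw [A.bidOf_eq g hx, mul_div_cancel₀ _ (A.F₁_pos hx).ne']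

lemma IsAdmissible.bidOf_nonneg (hg : A.IsAdmissible g) {x : ℝ} (hx : x ∈ Ioc A.a₁ A.a₂) :
    0 ≤ A.bidOf g x := by
  rw [A.bidOf_eq g hx]
  exact div_nonneg (hg.cumul_nonneg hx.2) (A.F₁_pos hx).le

lemma IsAdmissible.bidOf_le (hg : A.IsAdmissible g) {x : ℝ} (hx : x ∈ Ioc A.a₁ A.a₂) :
    A.bidOf g x ≤ g x := by
  rw [A.bidOf_eq g hx, div_le_iff₀ (A.F₁_pos hx)]
  simpa using hg.cumul_sub_le le_rfl hx.1.le hx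

lemma IsAdmissible.bidOf_monotoneOn (hg : A.IsAdmissible g) :
    MonotoneOn (A.bidOf g) (Ioc A.a₁ A.a₂) := by
  intro c hc d hd hcd
  have h1 := hg.le_cumul_sub hc hcd hd.2
  have h2 := hg.bidOf_le hc
  have h3 := A.F₁_strictMonoOn.monotoneOn (Ioc_subset_Icc_self hc) (Ioc_subset_Icc_self hd) hcd
  rw [A.bidOf_eq g hd, le_div_iff₀ (A.F₁_pos hd)]
  have h4 : A.F₁ c * A.bidOf g c = A.cumul g c := IsAdmissible.F₁_mul_bidOf hc
  nlinarith

end Laws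

variable {A : FirstPriceAuction}

/-! ### The follower's problem -/

section Follower

variable (s : Kernel ℝ ℝ)

lemma winProbB_nonneg (t : ℝ) : 0 ≤ A.winProbB s t := measureReal_nonneg

lemma bddBelow_bestResponses (y : ℝ) : BddBelow (A.bestResponses s y) := ⟨0, fun _ h => h.1⟩

lemma followerBid_nonneg (y : ℝ) : 0 ≤ A.followerBid s y := Real.sInf_nonneg fun _ h => h.1

lemma equalBid_le {x y : ℝ} (hy : y ∈ Icc 0 A.b₂)
    (h : A.equalUtilityCurve s y x = A.smoothed s x) : A.equalBid s x ≤ y :=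
  csInf_le ⟨0, fun _ hz => hz.1.1⟩ ⟨hy, h⟩

lemma F₁_mul_equalUtilityCurve {x : ℝ} (hx : x ∈ Ioc A.a₁ A.a₂) (y : ℝ) :
    A.F₁ x * A.equalUtilityCurve s y x = A.F₁ x * y - A.followerUtility s y := by
  have := (A.F₁_pos hx).ne'
  unfold equalUtilityCurve
  field_simp

variable [IsMarkovKernel s]

instance isProbabilityMeasure_bidLaw : IsProbabilityMeasure (A.bidLaw s) := by
  unfold bidLaw; infer_instance

lemma winProbB_eq_cdf (t : ℝ) : A.winProbB s t = cdf (A.bidLaw s) t := by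
  rw [cdf_eq_real, winProbB]

lemma winProbB_le_one (t : ℝ) : A.winProbB s t ≤ 1 := measureReal_le_one

lemma winProbB_mono : Monotone (A.winProbB s) := fun _ _ h =>
  measureReal_mono (Iic_subset_Iic.2 h)

lemma tendsto_winProbB (t : ℝ) : Tendsto (A.winProbB s) (𝓝[>] t) (𝓝 (A.winProbB s t)) := by
  simp only [funext (winProbB_eq_cdf (A := A) s)]
  exact ((cdf (A.bidLaw s)).right_continuous t).tendsto.mono_left (nhdsWithin_mono _ Ioi_subset_Ici_self)

lemma bddAbove_followerPayoff {y : ℝ} (hy : 0 ≤ y) :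
    BddAbove (A.followerPayoff s y '' Ici 0) := by
  refine ⟨y, ?_⟩
  rintro _ ⟨t, ht, rfl⟩
  have h1 := winProbB_nonneg (A := A) s t
  have h2 := winProbB_le_one (A := A) s t
  have ht : 0 ≤ t := ht
  unfold followerPayoff
  nlinarith

lemma followerPayoff_le {y t : ℝ} (hy : 0 ≤ y) (ht : 0 ≤ t) :
    A.followerPayoff s y t ≤ A.followerUtility s y :=
  le_csSup (bddAbove_followerPayoff s hy) ⟨t, ht, rfl⟩

lemma followerUtility_nonneg {y : ℝ} (hy : 0 ≤ y) : 0 ≤ A.followerUtility s y := by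
  simpa [followerPayoff] using followerPayoff_le (A := A) s hy hy

lemma followerUtility_zero : A.followerUtility s 0 = 0 := by
  refine le_antisymm (csSup_le ⟨_, 0, self_mem_Ici, rfl⟩ ?_) (followerUtility_nonneg s le_rfl)
  rintro _ ⟨t, ht, rfl⟩
  have ht : 0 ≤ t := ht
  have h1 := winProbB_nonneg (A := A) s t
  unfold followerPayoff
  nlinarith

lemma mem_bestResponses_iff {y t : ℝ} (hy : 0 ≤ y) :
    t ∈ A.bestResponses s y ↔ 0 ≤ t ∧ A.followerUtility s y ≤ A.followerPayoff s y t := by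
  refine and_congr_right fun ht => ⟨fun h => csSup_le ⟨_, 0, self_mem_Ici, rfl⟩ ?_,
    fun h t' ht' => (followerPayoff_le s hy ht').trans h⟩
  rintro _ ⟨t', ht', rfl⟩
  exact h t' ht'

lemma tendsto_followerPayoff (y t : ℝ) :
    Tendsto (A.followerPayoff s y) (𝓝[>] t) (𝓝 (A.followerPayoff s y t)) := by
  refine Tendsto.mul ?_ (tendsto_winProbB s t)
  exact ((continuous_const.sub continuous_id).tendsto t).mono_left nhdsWithin_le_nhds

/-- The winning probability is increasing and right-continuous, hence upper semicontinuous, and bids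
may be confined to the compact interval `[0, y]`; a limit of a maximizing sequence is then optimal.
-/
lemma bestResponses_nonempty {y : ℝ} (hy : 0 ≤ y) : (A.bestResponses s y).Nonempty := by
  obtain ⟨v, -, hv, hmem⟩ := exists_seq_tendsto_sSup (S := A.followerPayoff s y '' Ici 0)
    ⟨_, 0, self_mem_Ici, rfl⟩ (bddAbove_followerPayoff s hy)
  change Tendsto v atTop (𝓝 (A.followerUtility s y)) at hv
  choose τ hτ hτv using hmem
  -- bids above the valuation may be replaced by the valuation
  have hmin : ∀ n, v n ≤ A.followerPayoff s y (min (τ n) y) := fun n => by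
    rcases le_total (τ n) y with h | h
    · rw [min_eq_left h, hτv]
    · rw [min_eq_right h, ← hτv]
      have := winProbB_nonneg (A := A) s (τ n)
      simp only [followerPayoff, sub_self, zero_mul]
      nlinarith
  obtain ⟨t, ht, φ, hφ, hlim⟩ := (isCompact_Icc (a := (0 : ℝ)) (b := y)).tendsto_subseq
    (x := fun n => min (τ n) y) fun n => ⟨le_min (hτ n) hy, min_le_right _ _⟩
  refine ⟨t, (mem_bestResponses_iff s hy).2 ⟨ht.1, ?_⟩⟩
  -- The bids may approach `t` from above, so their winning probabilities are bounded by that of a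
  -- fixed `t' > t`; afterwards `t'` decreases to `t`.
  have key : ∀ t' ∈ Ioi t, A.followerUtility s y ≤ (y - t) * A.winProbB s t' := fun t' ht' => by
    refine le_of_tendsto_of_tendsto (hv.comp hφ.tendsto_atTop)
      ((tendsto_const_nhds.sub hlim).mul_const (A.winProbB s t')) ?_
    filter_upwards [hlim.eventually (eventually_lt_nhds (mem_Ioi.1 ht'))] with n hn
    exact (hmin (φ n)).trans (mul_le_mul_of_nonneg_left (winProbB_mono s hn.le)
      (sub_nonneg.2 (min_le_right _ _)))
  exact ge_of_tendsto ((tendsto_winProbB s t).const_mul (y - t))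
    (eventually_mem_nhdsWithin.mono key)

/-- If the infimum were not attained, best responses would converge to it strictly from above, and
right-continuity of the payoff would make it a best response after all. -/
lemma followerBid_mem {y : ℝ} (hy : 0 ≤ y) : A.followerBid s y ∈ A.bestResponses s y := by
  by_contra hcon
  obtain ⟨v, hv, hlim, hmem⟩ := exists_seq_tendsto_sInf (bestResponses_nonempty (A := A) s hy)
    (bddBelow_bestResponses s y)
  have hlim' : Tendsto v atTop (𝓝[>] A.followerBid s y) := by
    refine tendsto_nhdsWithin_iff.2 ⟨hlim, Eventually.of_forall fun n => ?_⟩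
    refine lt_of_le_of_ne (csInf_le (bddBelow_bestResponses s y) (hmem n)) fun h => hcon ?_
    exact (show A.followerBid s y = v n from h) ▸ hmem n
  refine hcon ((mem_bestResponses_iff s hy).2 ⟨Real.sInf_nonneg fun _ h => h.1, ?_⟩)
  exact ge_of_tendsto ((tendsto_followerPayoff s y _).comp hlim')
    (Eventually.of_forall fun n => ((mem_bestResponses_iff s hy).1 (hmem n)).2)

lemma followerUtility_eq {y : ℝ} (hy : 0 ≤ y) :
    A.followerUtility s y = (y - A.followerBid s y) * A.winProbB s (A.followerBid s y) :=
  le_antisymm ((mem_bestResponses_iff s hy).1 (followerBid_mem s hy)).2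
    (followerPayoff_le s hy (followerBid_nonneg s y))

/-- The winning probability at the best response is a subgradient of the utility. -/
lemma followerUtility_add_le {y y' : ℝ} (hy : 0 ≤ y) (hy' : 0 ≤ y') :
    A.followerUtility s y + A.winProbB s (A.followerBid s y) * (y' - y) ≤
      A.followerUtility s y' := by
  have := followerPayoff_le (A := A) s hy' (followerBid_nonneg (A := A) s y)
  rw [followerPayoff] at this
  rw [followerUtility_eq s hy]
  linarith

/-- Subgradients are winning probabilities, so they lie in `[0, 1]` and the utility is 1-Lipschitz.
-/
lemma followerUtility_continuousOn : ContinuousOn (A.followerUtility s) (Ici 0) := by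
  have : LipschitzOnWith 1 (A.followerUtility s) (Ici 0) := by
    refine LipschitzOnWith.of_le_add fun y hy y' hy' => ?_
    have h1 := followerUtility_add_le (A := A) s hy hy'
    have h2 := winProbB_nonneg (A := A) s (A.followerBid s y)
    have h3 := winProbB_le_one (A := A) s (A.followerBid s y)
    have h4 := neg_abs_le (y' - y)
    rw [Real.dist_eq, abs_sub_comm]
    nlinarith [abs_nonneg (y' - y), le_abs_self (y' - y)]
  exact this.continuousOn

/-! ### The equal-bid function of a strategy -/

lemma equalUtilityCurve_continuousOn (x : ℝ) :
    ContinuousOn (fun y => A.equalUtilityCurve s y x) (Icc 0 A.b₂) := by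
  have := (followerUtility_continuousOn (A := A) s).mono (show Icc 0 A.b₂ ⊆ Ici 0 from fun _ h => h.1)
  unfold equalUtilityCurve
  fun_prop

lemma equalUtilityCurve_le_smoothed {x y : ℝ} (hy : y ∈ Icc 0 A.b₂) :
    A.equalUtilityCurve s y x ≤ A.smoothed s x :=
  le_csSup (isCompact_Icc.image_of_continuousOn (equalUtilityCurve_continuousOn s x)).bddAbove
    ⟨y, hy, rfl⟩

lemma exists_equalUtilityCurve_eq (x : ℝ) :
    ∃ y ∈ Icc 0 A.b₂, A.equalUtilityCurve s y x = A.smoothed s x :=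
  (isCompact_Icc.image_of_continuousOn (equalUtilityCurve_continuousOn s x)).sSup_mem
    ((nonempty_Icc.2 A.b₂_pos.le).image _)

lemma equalBid_spec (x : ℝ) :
    A.equalBid s x ∈ Icc 0 A.b₂ ∧
      A.equalUtilityCurve s (A.equalBid s x) x = A.smoothed s x := by
  have hcl : IsClosed {y | y ∈ Icc 0 A.b₂ ∧ A.equalUtilityCurve s y x = A.smoothed s x} :=
    (equalUtilityCurve_continuousOn s x).preimage_isClosed_of_isClosed isClosed_Icc
      (isClosed_singleton (x := A.smoothed s x))
  obtain ⟨y, hy, hy'⟩ := exists_equalUtilityCurve_eq (A := A) s x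
  exact hcl.csInf_mem ⟨y, hy, hy'⟩ ⟨0, fun z hz => hz.1.1⟩

lemma le_F₁_mul_smoothed {x y : ℝ} (hx : x ∈ Ioc A.a₁ A.a₂) (hy : y ∈ Icc 0 A.b₂) :
    A.F₁ x * y - A.followerUtility s y ≤ A.F₁ x * A.smoothed s x := by
  rw [← F₁_mul_equalUtilityCurve s hx]
  exact mul_le_mul_of_nonneg_left (equalUtilityCurve_le_smoothed s hy) (A.F₁_pos hx).le

lemma F₁_mul_smoothed {x : ℝ} (hx : x ∈ Ioc A.a₁ A.a₂) :
    A.F₁ x * A.smoothed s x = A.F₁ x * A.equalBid s x - A.followerUtility s (A.equalBid s x) := by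
  rw [← (equalBid_spec s x).2, F₁_mul_equalUtilityCurve s hx]

/-- Minimality of the equal-bid function among the maximizers of `F₁ x * y - u_B y`, in the
division-free form that linear arithmetic can use. -/
lemma equalBid_le_of_le {x y : ℝ} (hx : x ∈ Ioc A.a₁ A.a₂) (hy : y ∈ Icc 0 A.b₂)
    (h : A.F₁ x * A.smoothed s x ≤ A.F₁ x * y - A.followerUtility s y) : A.equalBid s x ≤ y := by
  refine equalBid_le s hy (le_antisymm (equalUtilityCurve_le_smoothed s hy) ?_)
  rw [← F₁_mul_equalUtilityCurve s hx] at h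
  exact le_of_mul_le_mul_left h (A.F₁_pos hx)

/-- The equal-bid function at `x` is at least every valuation whose best response wins with
probability less than `F₁ x`. -/
lemma le_equalBid {x y : ℝ} (hx : x ∈ Ioc A.a₁ A.a₂) (hy : y ∈ Icc 0 A.b₂)
    (h : A.winProbB s (A.followerBid s y) < A.F₁ x) : y ≤ A.equalBid s x := by
  by_contra! hlt
  have h1 := (equalBid_spec (A := A) s x).1
  have h2 := followerUtility_add_le (A := A) s hy.1 h1.1
  have h3 := le_F₁_mul_smoothed s hx hy
  rw [F₁_mul_smoothed s hx] at h3
  nlinarith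

lemma equalBid_le_of_lt {x y : ℝ} (hx : x ∈ Ioc A.a₁ A.a₂) (hy : y ∈ Icc 0 A.b₂)
    (h : A.F₁ x < A.winProbB s (A.followerBid s y)) : A.equalBid s x ≤ y := by
  by_contra! hlt
  have h1 := (equalBid_spec (A := A) s x).1
  have h2 := followerUtility_add_le (A := A) s hy.1 h1.1
  have h3 := le_F₁_mul_smoothed s hx hy
  rw [F₁_mul_smoothed s hx] at h3
  nlinarith

/-- Increasing differences of `F₁ x * y - u_B y`: if `g x' < g x` with `x ≤ x'`, then `g x'` would
already be optimal at `x`, against the minimality of `g x`. -/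
lemma equalBid_monotoneOn : MonotoneOn (A.equalBid s) (Ioc A.a₁ A.a₂) := by
  intro x hx x' hx' hxx'
  have hF := A.F₁_strictMonoOn.monotoneOn (Ioc_subset_Icc_self hx) (Ioc_subset_Icc_self hx') hxx'
  by_contra! hlt
  have h1 := (equalBid_spec (A := A) s x).1
  have h1' := (equalBid_spec (A := A) s x').1
  refine hlt.not_ge (equalBid_le_of_le s hx h1' ?_)
  have h2 := le_F₁_mul_smoothed s hx' h1
  rw [F₁_mul_smoothed s hx'] at h2
  rw [F₁_mul_smoothed s hx]
  nlinarith

lemma tendsto_F₁_nhdsLT {x : ℝ} (hx : x ∈ Ioc A.a₁ A.a₂) :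
    Tendsto A.F₁ (𝓝[<] x) (𝓝 (A.F₁ x)) := by
  have h := (A.F₁_continuousOn x (Ioc_subset_Icc_self hx))
  refine h.mono_left (nhdsWithin_le_iff.2 ?_)
  filter_upwards [Ioo_mem_nhdsLT hx.1] with t ht using ⟨ht.1.le, ht.2.le.trans hx.2⟩

/-- Left-continuity comes from choosing the smallest maximizer: the limit from the left is again a
maximizer at `x`, hence not below the value at `x`. -/
lemma isAdmissible_equalBid : A.IsAdmissible (A.equalBid s) := by
  refine ⟨equalBid_monotoneOn s, fun x hx => ?_, fun x _ => (equalBid_spec s x).1⟩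
  have hsub : Ioo A.a₁ x ⊆ Ioc A.a₁ A.a₂ := fun t ht => ⟨ht.1, ht.2.le.trans hx.2⟩
  have hbdd : BddAbove (A.equalBid s '' Ioo A.a₁ x) :=
    ⟨A.b₂, by rintro _ ⟨t, -, rfl⟩; exact (equalBid_spec s t).1.2⟩
  have hlim : Tendsto (A.equalBid s) (𝓝[<] x) (𝓝 (sSup (A.equalBid s '' Ioo A.a₁ x))) := by
    have := ((equalBid_monotoneOn (A := A) s).mono hsub).tendsto_nhdsWithin_Ioo_left
      (nonempty_Ioo.2 hx.1) hbdd
    exact this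
  set l := sSup (A.equalBid s '' Ioo A.a₁ x) with hl
  have hmem : ∀ᶠ t in 𝓝[<] x, t ∈ Ioo A.a₁ x := Ioo_mem_nhdsLT hx.1
  have hl0 : l ∈ Icc 0 A.b₂ :=
    isClosed_Icc.mem_of_tendsto hlim (Eventually.of_forall fun t => (equalBid_spec s t).1)
  have hle : l ≤ A.equalBid s x := le_of_tendsto hlim (hmem.mono fun t ht =>
    equalBid_monotoneOn s (hsub ht) hx ht.2.le)
  have hge : A.equalBid s x ≤ l := by
    refine equalBid_le_of_le s hx hl0 ?_
    rw [F₁_mul_smoothed s hx]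
    have hu : Tendsto (fun t => A.followerUtility s (A.equalBid s t)) (𝓝[<] x)
        (𝓝 (A.followerUtility s l)) :=
      ((followerUtility_continuousOn s l hl0.1).tendsto).comp
        (tendsto_nhdsWithin_iff.2 ⟨hlim, Eventually.of_forall fun t => (equalBid_spec s t).1.1⟩)
    refine le_of_tendsto_of_tendsto
      (((tendsto_F₁_nhdsLT hx).mul_const (A.equalBid s x)).sub_const _)
      (((tendsto_F₁_nhdsLT hx).mul hlim).sub hu) (hmem.mono fun t ht => ?_)
    have := le_F₁_mul_smoothed s (hsub ht) (equalBid_spec (A := A) s x).1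
    rwa [F₁_mul_smoothed s (hsub ht)] at this
  rw [← continuousWithinAt_Iio_iff_Iic, ContinuousWithinAt, le_antisymm hge hle]
  exact hlim

/-- A function whose increments are controlled by products of increments of monotone functions,
one of them continuous, is constant. -/
lemma eq_of_abs_sub_le_mul {d g : ℝ → ℝ}
    (h : ∀ x ∈ Ioc A.a₁ A.a₂, ∀ y ∈ Ioc A.a₁ A.a₂, x ≤ y →
      |d y - d x| ≤ (g y - g x) * (A.F₁ y - A.F₁ x)) {x y : ℝ}
    (hx : x ∈ Ioc A.a₁ A.a₂) (hy : y ∈ Ioc A.a₁ A.a₂) (hxy : x ≤ y) : d y = d x := by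
  have key : ∀ n : ℕ, ∀ x ∈ Ioc A.a₁ A.a₂, ∀ y ∈ Ioc A.a₁ A.a₂, x ≤ y →
      |d y - d x| ≤ (g y - g x) * (A.F₁ y - A.F₁ x) * (1 / 2) ^ n := by
    intro n
    induction n with
    | zero => simpa using h
    | succ n ih =>
      intro x hx y hy hxy
      have hF := A.F₁_strictMonoOn.monotoneOn (Ioc_subset_Icc_self hx) (Ioc_subset_Icc_self hy) hxy
      have hc : ContinuousOn A.F₁ (Icc x y) :=
        A.F₁_continuousOn.mono fun t ht => ⟨hx.1.le.trans ht.1, ht.2.trans hy.2⟩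
      -- The interval is bisected in the scale of `F₁`. The two increments of `g` add up and each
      -- carries half the increment of `F₁`, so the bound is halved.
      obtain ⟨m, hm, hmF⟩ := intermediate_value_Icc hxy hc
        (show (A.F₁ x + A.F₁ y) / 2 ∈ Icc (A.F₁ x) (A.F₁ y) from ⟨by linarith, by linarith⟩)
      have hm' : m ∈ Ioc A.a₁ A.a₂ := ⟨hx.1.trans_le hm.1, hm.2.trans hy.2⟩
      have h1 := ih x hx m hm' hm.1
      have h2 := ih m hm' y hy hm.2
      have h3 := abs_sub_le (d y) (d m) (d x)
      rw [hmF] at h1 h2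
      rw [pow_succ]
      linarith
  have hlim : Tendsto (fun n : ℕ => (g y - g x) * (A.F₁ y - A.F₁ x) * (1 / 2 : ℝ) ^ n) atTop
      (𝓝 0) := by
    simpa using (tendsto_pow_atTop_nhds_zero_of_lt_one (by norm_num : (0 : ℝ) ≤ 1 / 2)
      (by norm_num)).const_mul ((g y - g x) * (A.F₁ y - A.F₁ x))
  have := ge_of_tendsto' hlim fun n => key n x hx y hy hxy
  exact sub_eq_zero.1 (abs_eq_zero.1 (le_antisymm this (abs_nonneg _)))

/-- The envelope theorem for the smoothed strategy. -/
lemma cumul_equalBid {x : ℝ} (hx : x ∈ Ioc A.a₁ A.a₂) :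
    A.cumul (A.equalBid s) x = A.F₁ x * A.smoothed s x := by
  have hg := isAdmissible_equalBid (A := A) s
  set d : ℝ → ℝ := fun x => A.F₁ x * A.smoothed s x - A.cumul (A.equalBid s) x with hd
  have hconst : ∀ x ∈ Ioc A.a₁ A.a₂, ∀ y ∈ Ioc A.a₁ A.a₂, x ≤ y → d y = d x := by
    intro x hx y hy hxy
    refine eq_of_abs_sub_le_mul (A := A) (g := A.equalBid s) ?_ hx hy hxy
    intro x hx y hy hxy
    have h1 := le_F₁_mul_smoothed s hx (equalBid_spec (A := A) s y).1
    have h2 := le_F₁_mul_smoothed s hy (equalBid_spec (A := A) s x).1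
    have h3 := F₁_mul_smoothed (A := A) s hx
    have h4 := F₁_mul_smoothed (A := A) s hy
    have h5 := hg.cumul_sub_le hx.1.le hxy hy
    have h6 := hg.le_cumul_sub hx hxy hy.2
    -- The increments of both `F₁ * s*` and `cumul` lie between `g x * ΔF₁` and `g y * ΔF₁`.
    simp only [hd, abs_le]
    constructor <;> nlinarith
  -- This bound tends to `0` at `a₁` and so fixes the constant. Both terms of `d` are at most `b₂ *
  -- F₁` in absolute value; that `s*` is nonnegative uses the follower with valuation `0`.
  have hbound : ∀ y ∈ Ioc A.a₁ A.a₂, |d y| ≤ 2 * A.b₂ * A.F₁ y := by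
    intro y hy
    have h1 := abs_cumul_le hg.integrable hg.abs_le (Ioc_subset_Icc_self hy)
    have h2 := F₁_mul_smoothed (A := A) s hy
    have h3 := (equalBid_spec (A := A) s y).1
    have h4 := followerUtility_nonneg (A := A) s h3.1
    have h5 := le_F₁_mul_smoothed (A := A) s hy (left_mem_Icc.2 A.b₂_pos.le)
    rw [followerUtility_zero] at h5
    have h6 := A.F₁_pos hy
    have h7 := mul_le_mul_of_nonneg_left h3.2 h6.le
    rw [abs_le] at h1
    simp only [hd, abs_le]
    constructor <;> nlinarith
  have hzero : |d x| ≤ 0 := by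
    have hlim : Tendsto (fun y => 2 * A.b₂ * A.F₁ y) (𝓝[>] A.a₁) (𝓝 0) := by
      have : Tendsto A.F₁ (𝓝[>] A.a₁) (𝓝 0) := by
        have h := A.F₁_continuousOn A.a₁ (left_mem_Icc.2 A.a₁_lt_a₂.le)
        rw [ContinuousWithinAt, F₁_left] at h
        exact h.mono_left (nhdsWithin_le_iff.2
          (mem_of_superset (Ioo_mem_nhdsGT A.a₁_lt_a₂) Ioo_subset_Icc_self))
      simpa using this.const_mul (2 * A.b₂)
    refine ge_of_tendsto hlim ?_
    filter_upwards [Ioo_mem_nhdsGT hx.1] with y hy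
    have hy' : y ∈ Ioc A.a₁ A.a₂ := ⟨hy.1, hy.2.le.trans hx.2⟩
    rw [hconst y hy' x hx hy.2.le]
    exact hbound y hy'
  have := abs_eq_zero.1 (le_antisymm hzero (abs_nonneg _))
  simp only [hd] at this
  linarith

lemma bidOf_equalBid {x : ℝ} (hx : x ∈ Ioc A.a₁ A.a₂) :
    A.bidOf (A.equalBid s) x = A.smoothed s x := by
  rw [A.bidOf_eq _ hx, cumul_equalBid s hx, mul_div_cancel_left₀ _ (A.F₁_pos hx).ne']

end Follower

/-! ### The objective as an integral over both valuations -/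

/-- The follower's law has no atoms, so the case `y = g x`, in which the winner depends on
tie-breaking, is negligible. -/
lemma ae_ne_prod {g : ℝ → ℝ} (hm : AEMeasurable g A.leaderLaw) :
    ∀ᵐ z ∂A.leaderLaw.prod A.followerLaw, g z.1 ≠ z.2 := by
  have h : ∀ᵐ z ∂A.leaderLaw.prod A.followerLaw, hm.mk g z.1 ≠ z.2 := by
    rw [Measure.ae_prod_iff_ae_ae (p := fun z => hm.mk g z.1 ≠ z.2)
      (measurableSet_eq_fun (hm.measurable_mk.comp measurable_fst) measurable_snd).compl]
    refine Eventually.of_forall fun x => ?_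
    simp only [ne_comm (a := hm.mk g x)]
    exact compl_mem_ae_iff.2 (measure_singleton _)
  filter_upwards [h, Measure.quasiMeasurePreserving_fst.ae hm.ae_eq_mk] with z h1 h2
  rwa [h2]

lemma ae_ne_followerLaw {g : ℝ → ℝ} (hm : AEMeasurable g A.leaderLaw) :
    ∀ᵐ y ∂A.followerLaw, ∀ᵐ x ∂A.leaderLaw, g x ≠ y :=
  Measure.ae_ae_of_ae_prod
    (Measure.measurePreserving_swap.quasiMeasurePreserving.ae (ae_ne_prod hm))

open Classical in
/-- The leader's payoff at the valuations `(x, y)` if he bids `bidOf g x` and wins exactly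
against the followers below `g x`. -/
noncomputable def equalBidPayoff (A : FirstPriceAuction) (g : ℝ → ℝ) (z : ℝ × ℝ) : ℝ :=
  if z.2 < g z.1 then z.1 - A.bidOf g z.1 else 0

lemma integrable_equalBidPayoff {g : ℝ → ℝ} (hg : A.IsAdmissible g) :
    Integrable (A.equalBidPayoff g) (A.leaderLaw.prod A.followerLaw) := by
  have hgm : AEMeasurable (fun z : ℝ × ℝ => g z.1) (A.leaderLaw.prod A.followerLaw) :=
    hg.aemeasurable.comp_fst
  have hbm : AEMeasurable (fun z : ℝ × ℝ => A.bidOf g z.1) (A.leaderLaw.prod A.followerLaw) :=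
    (aemeasurable_bidOf hg.integrable).comp_fst
  have hmeas : AEStronglyMeasurable (A.equalBidPayoff g) (A.leaderLaw.prod A.followerLaw) := by
    have := (measurable_fst.aemeasurable.sub hbm).aestronglyMeasurable.indicator₀
      (nullMeasurableSet_lt measurable_snd.aemeasurable hgm)
    refine this.congr (Eventually.of_forall fun z => ?_)
    simp [equalBidPayoff, indicator]
  refine Integrable.of_bound hmeas (A.a₂ + A.b₂) ?_
  have hx : ∀ᵐ z ∂A.leaderLaw.prod A.followerLaw, z.1 ∈ Ioc A.a₁ A.a₂ :=
    Measure.quasiMeasurePreserving_fst.ae A.ae_mem_Ioc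
  filter_upwards [hx] with z hz
  have h1 := abs_bidOf_le hg.integrable hg.abs_le hz
  have h2 := A.a₁_nonneg
  have h3 := A.a₁_lt_a₂
  have h4 := A.b₂_pos
  rw [abs_le] at h1
  rw [equalBidPayoff, Real.norm_eq_abs]
  split_ifs
  · rw [abs_le]; constructor <;> linarith [hz.1, hz.2]
  · rw [abs_zero]; linarith

lemma integral_equalBidPayoff {g : ℝ → ℝ} (hg : A.IsAdmissible g) :
    ∫ z, A.equalBidPayoff g z ∂(A.leaderLaw.prod A.followerLaw) = A.objective g := by
  rw [integral_prod _ (integrable_equalBidPayoff hg), A.objective_eq]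
  congr 1 with x
  have : (fun y => A.equalBidPayoff g (x, y)) = (Iio (g x)).indicator fun _ => x - A.bidOf g x := by
    ext y; simp [equalBidPayoff, indicator]
  rw [this, integral_indicator_const _ measurableSet_Iio, A.F₂_eq_real_Iio, smul_eq_mul, mul_comm]

/-! ### No strategy beats its smoothed strategy -/

/-- Stochastic dominance through the layer-cake formula. The two functions live on different spaces:
valuations on one side, pairs of valuation and bid on the other. -/
lemma integral_le_integral_of_measure_lt_le {α β : Type*} [MeasurableSpace α] [MeasurableSpace β]
    {μ : Measure α} {ν : Measure β} {f : α → ℝ} {h : β → ℝ} (hf : AEStronglyMeasurable f μ)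
    (hf0 : 0 ≤ᵐ[μ] f) (hh : Integrable h ν) (hh0 : 0 ≤ᵐ[ν] h)
    (hle : ∀ t, 0 ≤ t → μ {x | t < f x} ≤ ν {x | t < h x}) : ∫ x, f x ∂μ ≤ ∫ x, h x ∂ν := by
  rw [integral_eq_lintegral_of_nonneg_ae hf0 hf,
    integral_eq_lintegral_of_nonneg_ae hh0 hh.aestronglyMeasurable]
  refine ENNReal.toReal_mono ?_ ?_
  · rw [← lt_top_iff_ne_top]
    exact (hasFiniteIntegral_iff_ofReal hh0).1 hh.2
  · rw [lintegral_eq_lintegral_meas_lt μ hf0 hf.aemeasurable,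
      lintegral_eq_lintegral_meas_lt ν hh0 hh.aestronglyMeasurable.aemeasurable]
    exact setLIntegral_mono' measurableSet_Ioi fun t ht => hle t (le_of_lt ht)

lemma integrable_id_leaderLaw : Integrable (fun x : ℝ => x) A.leaderLaw :=
  integrable_of_ae_abs_le aemeasurable_id (C := A.a₂) (A.ae_mem_Ioc.mono fun x hx => by
    rw [abs_of_pos (A.a₁_nonneg.trans_lt hx.1)]; exact hx.2)

section Strategy

variable (s : Kernel ℝ ℝ) [IsMarkovKernel s]

/-- Otherwise the follower with valuation `g x ≥ s*(x)` would get at least `(g x - t) * F₁ x > (g x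
- s*(x)) * F₁ x = u_B(g x)` by bidding `t`. -/
lemma winProbB_lt_of_lt_smoothed {x t : ℝ} (hx : x ∈ Ioc A.a₁ A.a₂) (ht : 0 ≤ t)
    (h : t < A.smoothed s x) : A.winProbB s t < A.F₁ x := by
  by_contra! hle
  have hg := (isAdmissible_equalBid (A := A) s)
  have h1 := hg.bidOf_le hx
  rw [bidOf_equalBid s hx] at h1
  have h2 := F₁_mul_smoothed (A := A) s hx
  have h3 := followerPayoff_le (A := A) s (equalBid_spec (A := A) s x).1.1 ht
  rw [followerPayoff] at h3
  have := A.F₁_pos hx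
  nlinarith

lemma exists_F₁_eq_winProbB (t : ℝ) : ∃ x ∈ Icc A.a₁ A.a₂, A.F₁ x = A.winProbB s t :=
  A.exists_F₁_eq ⟨winProbB_nonneg s t, winProbB_le_one s t⟩

lemma compProd_real_snd_gt (t : ℝ) :
    (A.leaderLaw.compProd s).real {p | t < p.2} = 1 - A.winProbB s t := by
  have h : (A.leaderLaw.compProd s).snd = A.bidLaw s := Measure.snd_compProd _ _
  rw [winProbB, ← probReal_compl_eq_one_sub measurableSet_Iic, ← h, compl_Iic,
    Measure.real, Measure.real, Measure.snd_apply measurableSet_Ioi]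
  rfl

lemma integral_fst_compProd {h : ℝ → ℝ} (hh : AEStronglyMeasurable h A.leaderLaw) :
    ∫ p, h p.1 ∂(A.leaderLaw.compProd s) = ∫ x, h x ∂A.leaderLaw := by
  have e : (A.leaderLaw.compProd s).map Prod.fst = A.leaderLaw := Measure.fst_compProd _ _
  rw [← integral_map (f := h) measurable_fst.aemeasurable (by rwa [e]), e]

lemma integrable_fst_compProd :
    Integrable (fun p : ℝ × ℝ => p.1) (A.leaderLaw.compProd s) := by
  have e : (A.leaderLaw.compProd s).map Prod.fst = A.leaderLaw := Measure.fst_compProd _ _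
  have := integrable_id_leaderLaw (A := A)
  rw [← e] at this
  exact this.comp_measurable measurable_fst

/-- Winning with a given probability, the leader has the largest expected valuation if he wins
with his highest valuations. -/
lemma setIntegral_fst_le {t c : ℝ} (hc : c ∈ Icc A.a₁ A.a₂) (hct : A.F₁ c = A.winProbB s t) :
    ∫ p in {p | t < p.2}, p.1 ∂(A.leaderLaw.compProd s) ≤ ∫ x in Ioi c, x ∂A.leaderLaw := by
  have hS : MeasurableSet {p : ℝ × ℝ | t < p.2} := measurableSet_lt measurable_const measurable_snd
  have hint := integrable_fst_compProd (A := A) s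
  have hmax : Integrable (fun p : ℝ × ℝ => max (p.1 - c) 0) (A.leaderLaw.compProd s) :=
    (hint.sub (integrable_const c)).pos_part
  -- The integral of `(x - c)⁺` depends only on the law of the valuation. The constant `c` cancels
  -- in the end because both winning events have mass `1 - F₁ c`.
  have h1 : ∫ p in {p | t < p.2}, (p.1 - c) ∂(A.leaderLaw.compProd s) ≤
      ∫ p, max (p.1 - c) 0 ∂(A.leaderLaw.compProd s) :=
    (setIntegral_mono (hint.sub (integrable_const c)).integrableOn hmax.integrableOn
      fun p => le_max_left _ _).trans
      (setIntegral_le_integral hmax (Eventually.of_forall fun p => le_max_right _ _))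
  have h2 : ∫ p, max (p.1 - c) 0 ∂(A.leaderLaw.compProd s) =
      ∫ x in Ioi c, (x - c) ∂A.leaderLaw := by
    rw [integral_fst_compProd (h := fun x => max (x - c) 0) s (by fun_prop),
      ← integral_indicator measurableSet_Ioi]
    congr 1 with x
    by_cases hx : c < x
    · rw [indicator_of_mem (mem_Ioi.2 hx), max_eq_left (by linarith)]
    · rw [indicator_of_notMem (by simpa using hx), max_eq_right (by linarith)]
  rw [h2, integral_sub hint.integrableOn (integrable_const c).integrableOn,
    integral_sub integrable_id_leaderLaw.integrableOn (integrable_const c).integrableOn,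
    setIntegral_const, setIntegral_const, compProd_real_snd_gt, A.leaderLaw_real_Ioi hc, hct] at h1
  linarith

/-- The leader's expected payment is at least that of the smoothed strategy. -/
lemma le_setIntegral_snd {t c : ℝ} (ht : 0 ≤ t) (hc : c ∈ Icc A.a₁ A.a₂)
    (hct : A.F₁ c = A.winProbB s t)
    (hint : IntegrableOn (fun p : ℝ × ℝ => p.2) {p | t < p.2} (A.leaderLaw.compProd s)) :
    ∫ x in Ioi c, A.bidOf (A.equalBid s) x ∂A.leaderLaw ≤
      ∫ p in {p | t < p.2}, p.2 ∂(A.leaderLaw.compProd s) := by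
  have hS : MeasurableSet {p : ℝ × ℝ | t < p.2} := measurableSet_lt measurable_const measurable_snd
  have hg := isAdmissible_equalBid (A := A) s
  rw [← integral_indicator hS, ← integral_indicator measurableSet_Ioi]
  refine integral_le_integral_of_measure_lt_le
    ((aemeasurable_bidOf hg.integrable).aestronglyMeasurable.indicator measurableSet_Ioi) ?_
    ((integrable_indicator_iff hS).2 hint)
    (Eventually.of_forall fun p => indicator_nonneg (fun p hp => ht.trans (le_of_lt hp)) p) ?_
  · filter_upwards [A.ae_mem_Ioc] with x hx
    exact indicator_apply_nonneg fun _ => hg.bidOf_nonneg hx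
  intro r hr
  -- Tails at level `r` are compared through the quantile `d`: under `s` the event of a bid above
  -- `max t r` has exactly the mass of the valuations above `d`.
  obtain ⟨d, hd, hdF⟩ := exists_F₁_eq_winProbB (A := A) s (max t r)
  have h1 : A.leaderLaw {x | r < (Ioi c).indicator (A.bidOf (A.equalBid s)) x} ≤
      A.leaderLaw (Ioi d) := by
    refine measure_mono_ae ?_
    filter_upwards [A.ae_mem_Ioc] with x hx hxr
    have hxr : r < (Ioi c).indicator (A.bidOf (A.equalBid s)) x := hxr
    have hcx : c < x := by
      by_contra hcx
      rw [indicator_of_notMem (by simpa using hcx)] at hxr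
      exact hxr.not_ge hr
    rw [indicator_of_mem (mem_Ioi.2 hcx), bidOf_equalBid s hx] at hxr
    refine (A.F₁_strictMonoOn.lt_iff_lt hd (Ioc_subset_Icc_self hx)).1 ?_
    rw [hdF]
    rcases le_total t r with h | h
    · rw [max_eq_right h]; exact winProbB_lt_of_lt_smoothed s hx hr hxr
    · rw [max_eq_left h, ← hct]
      exact A.F₁_strictMonoOn hc (Ioc_subset_Icc_self hx) hcx
  have h2 : {p : ℝ × ℝ | max t r < p.2} ⊆
      {p | r < ({p : ℝ × ℝ | t < p.2}).indicator (fun p => p.2) p} := by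
    intro p hp
    have hp : t < p.2 ∧ r < p.2 := max_lt_iff.1 hp
    simpa [indicator, hp.1] using hp.2
  refine h1.trans (le_trans (le_of_eq ?_) (measure_mono h2))
  rw [← measureReal_eq_measureReal_iff, A.leaderLaw_real_Ioi hd, compProd_real_snd_gt, hdF]

/-- The comparison for one fixed follower. Her winning probability is a subgradient of `u_B` at `y`,
so up to a null set the event `y < g x` is the event that `x` exceeds the corresponding quantile
`c`. -/
lemma integral_leaderPayoff_le {y : ℝ} (hy : y ∈ Icc 0 A.b₂)
    (hne : ∀ᵐ x ∂A.leaderLaw, A.equalBid s x ≠ y)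
    (hint : Integrable (fun p => A.leaderPayoff s (p, y)) (A.leaderLaw.compProd s)) :
    ∫ p, A.leaderPayoff s (p, y) ∂(A.leaderLaw.compProd s) ≤
      ∫ x, A.equalBidPayoff (A.equalBid s) (x, y) ∂A.leaderLaw := by
  set t := A.followerBid s y with ht
  have hS : MeasurableSet {p : ℝ × ℝ | t < p.2} := measurableSet_lt measurable_const measurable_snd
  have hpay : (fun p => A.leaderPayoff s (p, y)) =
      ({p : ℝ × ℝ | t < p.2}).indicator fun p => p.1 - p.2 := by
    ext p; simp [leaderPayoff, indicator, ht]
  rw [hpay, integrable_indicator_iff hS] at hint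
  rw [hpay, integral_indicator hS]
  have hg := isAdmissible_equalBid (A := A) s
  have hfst := integrable_fst_compProd (A := A) s
  have hsnd : IntegrableOn (fun p : ℝ × ℝ => p.2) {p | t < p.2} (A.leaderLaw.compProd s) := by
    exact (hfst.integrableOn.sub hint).congr (Eventually.of_forall fun p => by simp)
  -- The leader wins under `s` with probability `1 - F₁ c`, the mass of the valuations above `c`.
  obtain ⟨c, hc, hcF⟩ := exists_F₁_eq_winProbB (A := A) s t
  have h1 := setIntegral_fst_le s hc hcF
  have h2 := le_setIntegral_snd s (followerBid_nonneg s y) hc hcF hsnd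
  have hb : Integrable (A.bidOf (A.equalBid s)) A.leaderLaw :=
    integrable_of_ae_abs_le (aemeasurable_bidOf hg.integrable) (C := A.b₂)
      (A.ae_mem_Ioc.mono fun x hx => abs_bidOf_le hg.integrable hg.abs_le hx)
  have h3 : ∫ x, A.equalBidPayoff (A.equalBid s) (x, y) ∂A.leaderLaw =
      ∫ x in Ioi c, (x - A.bidOf (A.equalBid s) x) ∂A.leaderLaw := by
    rw [← integral_indicator measurableSet_Ioi]
    refine integral_congr_ae ?_
    have hxc : ∀ᵐ x ∂A.leaderLaw, x ≠ c := compl_mem_ae_iff.2 (measure_singleton c)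
    filter_upwards [A.ae_mem_Ioc, hne, hxc] with x hx hxy hxc
    have hiff : y < A.equalBid s x ↔ c < x := by
      constructor
      · intro h
        by_contra! hle
        have := A.F₁_strictMonoOn (Ioc_subset_Icc_self hx) hc (lt_of_le_of_ne hle hxc)
        rw [hcF] at this
        exact h.not_ge (equalBid_le_of_lt s hx hy this)
      · intro h
        have := A.F₁_strictMonoOn hc (Ioc_subset_Icc_self hx) h
        rw [hcF] at this
        exact lt_of_le_of_ne (le_equalBid s hx hy this) hxy.symm
    simp [equalBidPayoff, indicator, hiff]
  rw [h3, integral_sub hfst.integrableOn hsnd,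
    integral_sub integrable_id_leaderLaw.integrableOn hb.integrableOn]
  linarith

end Strategy

lemma leaderUtility_le_objective {s : Kernel ℝ ℝ} (hs : A.IsStrategy s) :
    A.leaderUtility s ≤ A.objective (A.equalBid s) := by
  have := hs.1
  have hg := isAdmissible_equalBid (A := A) s
  have hint : Integrable (A.leaderPayoff s) ((A.leaderLaw.compProd s).prod A.followerLaw) := hs.2
  rw [leaderUtility, outcomeLaw, integral_prod_symm _ hint, ← integral_equalBidPayoff hg,
    integral_prod_symm _ (integrable_equalBidPayoff hg)]
  refine integral_mono_ae hint.integral_prod_right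
    (integrable_equalBidPayoff hg).integral_prod_right ?_
  filter_upwards [A.ae_mem_Icc_followerLaw, ae_ne_followerLaw hg.aemeasurable, hint.prod_left_ae]
    with y hy hne hi
  exact integral_leaderPayoff_le s ⟨A.b₁_nonneg.trans hy.1, hy.2⟩ hne hi

/-! ### The strategy of an admissible function -/

lemma measurable_indicator_bidOf {g : ℝ → ℝ} (hg : A.IsAdmissible g) :
    Measurable ((Ioc A.a₁ A.a₂).indicator (A.bidOf g)) := by
  classical
  rw [← piecewise_eq_indicator]
  exact (bidOf_continuousOn hg.integrable).measurable_piecewise continuousOn_const measurableSet_Ioc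

/-- The deterministic strategy bidding `bidOf g x` at the valuation `x`. -/
noncomputable def bidStrategy {g : ℝ → ℝ} (hg : A.IsAdmissible g) : Kernel ℝ ℝ :=
  Kernel.deterministic ((Ioc A.a₁ A.a₂).indicator (A.bidOf g)) (measurable_indicator_bidOf hg)

section BidStrategy

variable {g : ℝ → ℝ} (hg : A.IsAdmissible g)

instance isMarkovKernel_bidStrategy : IsMarkovKernel (bidStrategy hg) := by
  unfold bidStrategy; infer_instance

lemma winProbB_bidStrategy (t : ℝ) :
    A.winProbB (bidStrategy hg) t = A.leaderLaw.real {x ∈ Ioc A.a₁ A.a₂ | A.bidOf g x ≤ t} := by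
  have h : A.bidLaw (bidStrategy hg) =
      A.leaderLaw.map ((Ioc A.a₁ A.a₂).indicator (A.bidOf g)) :=
    Measure.deterministic_comp_eq_map _
  rw [winProbB, h, map_measureReal_apply (measurable_indicator_bidOf hg) measurableSet_Iic]
  refine measureReal_congr ?_
  filter_upwards [A.ae_mem_Ioc] with x hx
  refine propext (show (Ioc A.a₁ A.a₂).indicator (A.bidOf g) x ≤ t ↔
    x ∈ Ioc A.a₁ A.a₂ ∧ A.bidOf g x ≤ t from ?_)
  rw [indicator_of_mem hx]
  exact ⟨fun h => ⟨hx, h⟩, fun h => h.2⟩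

lemma F₁_le_winProbB {x t : ℝ} (hx : x ∈ Ioc A.a₁ A.a₂) (ht : A.bidOf g x ≤ t) :
    A.F₁ x ≤ A.winProbB (bidStrategy hg) t := by
  rw [winProbB_bidStrategy, ← sub_zero (A.F₁ x), ← A.F₁_left,
    ← A.leaderLaw_real_Ioc le_rfl hx.1.le hx.2]
  refine measureReal_mono fun z hz => ?_
  have hz' : z ∈ Ioc A.a₁ A.a₂ := ⟨hz.1, hz.2.trans hx.2⟩
  exact ⟨hz', (hg.bidOf_monotoneOn hz' hx hz.2).trans ht⟩

/-- The bid is continuous and increasing in the valuation, so the valuations bidding at most `t`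
form an initial interval that contains its right end. -/
lemma winProbB_eq_zero_or (t : ℝ) : A.winProbB (bidStrategy hg) t = 0 ∨
    ∃ x ∈ Ioc A.a₁ A.a₂, A.winProbB (bidStrategy hg) t = A.F₁ x ∧ A.bidOf g x ≤ t := by
  rw [winProbB_bidStrategy]
  rcases eq_empty_or_nonempty {x ∈ Ioc A.a₁ A.a₂ | A.bidOf g x ≤ t} with h | ⟨z, hz, hzt⟩
  · left; rw [h, measureReal_empty]
  right
  have hsub : Icc z A.a₂ ⊆ Ioc A.a₁ A.a₂ := fun x hx => ⟨hz.1.trans_le hx.1, hx.2⟩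
  have hK : IsCompact (Icc z A.a₂ ∩ A.bidOf g ⁻¹' Iic t) :=
    isCompact_Icc.of_isClosed_subset
      (((bidOf_continuousOn hg.integrable).mono hsub).preimage_isClosed_of_isClosed isClosed_Icc
        isClosed_Iic) inter_subset_left
  obtain ⟨c, ⟨hc, hct⟩, hmax⟩ := hK.exists_isGreatest ⟨z, ⟨le_rfl, hz.2⟩, hzt⟩
  have hc' := hsub hc
  refine ⟨c, hc', ?_, hct⟩
  have hset : {x ∈ Ioc A.a₁ A.a₂ | A.bidOf g x ≤ t} = Ioc A.a₁ c := by
    ext x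
    refine ⟨fun ⟨hx, hxt⟩ => ⟨hx.1, ?_⟩, fun hx => ?_⟩
    · rcases le_total z x with h | h
      · exact hmax ⟨⟨h, hx.2⟩, hxt⟩
      · exact h.trans hc.1
    · have hx' : x ∈ Ioc A.a₁ A.a₂ := ⟨hx.1, hx.2.trans hc.2⟩
      exact ⟨hx', (hg.bidOf_monotoneOn hx' hc' hx.2).trans hct⟩
  rw [hset, A.leaderLaw_real_Ioc le_rfl hc'.1.le hc'.2, F₁_left, sub_zero]

/-- The follower can bid `bidOf g x`, which wins with probability at least `F₁ x`; if that bid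
exceeds `y`, the left side is negative anyway. Hence `u_B` dominates the conjugate of `cumul g` as a
function of `F₁`. -/
lemma le_followerUtility_bidStrategy {x y : ℝ} (hx : x ∈ Ioc A.a₁ A.a₂) (hy : 0 ≤ y) :
    A.F₁ x * y - A.cumul g x ≤ A.followerUtility (bidStrategy hg) y := by
  have h1 := followerPayoff_le (A := A) (bidStrategy hg) hy (hg.bidOf_nonneg hx)
  have h2 := F₁_le_winProbB hg hx le_rfl
  have h3 := followerUtility_nonneg (A := A) (bidStrategy hg) hy
  have h4 : A.F₁ x * A.bidOf g x = A.cumul g x := IsAdmissible.F₁_mul_bidOf hx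
  have h5 := A.F₁_pos hx
  rw [followerPayoff] at h1
  rcases le_total (A.bidOf g x) y with h | h <;> nlinarith

/-- Just left of `x` the function `g` still exceeds `y`, so moving there lowers `cumul g` by more
than `y * F₁`. This use of left-continuity makes `g x` the smallest maximizer. -/
lemma lt_followerUtility_bidStrategy {x y : ℝ} (hx : x ∈ Ioc A.a₁ A.a₂) (hy : 0 ≤ y)
    (hyx : y < g x) : A.F₁ x * y - A.cumul g x < A.followerUtility (bidStrategy hg) y := by
  obtain ⟨c, hc, hcx, h⟩ := hg.exists_lt hx hyx
  have hc' : c ∈ Ioc A.a₁ A.a₂ := ⟨hc, hcx.le.trans hx.2⟩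
  have h1 := le_followerUtility_bidStrategy hg hc' hy
  have h2 := hg.le_cumul_sub hc' hcx.le hx.2
  have h3 := A.F₁_strictMonoOn (Ioc_subset_Icc_self hc') (Ioc_subset_Icc_self hx) hcx
  have h4 := h c (left_mem_Icc.2 hcx.le)
  nlinarith

/-- The best response to `bidStrategy` yields zero or the utility on an equal-utility curve. -/
lemma followerUtility_bidStrategy_le {y : ℝ} (hy : 0 ≤ y) :
    (A.followerUtility (bidStrategy hg) y = 0 ∧
      A.winProbB (bidStrategy hg) (A.followerBid (bidStrategy hg) y) = 0) ∨
    ∃ x ∈ Ioc A.a₁ A.a₂, A.winProbB (bidStrategy hg) (A.followerBid (bidStrategy hg) y) = A.F₁ x ∧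
      A.bidOf g x ≤ A.followerBid (bidStrategy hg) y ∧
      A.followerUtility (bidStrategy hg) y ≤ A.F₁ x * y - A.cumul g x := by
  have hu := followerUtility_eq (A := A) (bidStrategy hg) hy
  rcases winProbB_eq_zero_or hg (A.followerBid (bidStrategy hg) y) with h | ⟨x, hx, h, hxt⟩
  · left; rw [hu, h]; simp
  · right
    refine ⟨x, hx, h, hxt, ?_⟩
    rw [hu, h, ← IsAdmissible.F₁_mul_bidOf hx]
    have := A.F₁_pos hx
    nlinarith

/-- A bid of at least `bidOf g x` yields at most the value at some `z ≥ x`. Beyond `x` that value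
does not increase, since `g ≥ g x > y` there, and at `x` it is already strictly suboptimal. -/
lemma followerBid_lt_bidOf {x y : ℝ} (hx : x ∈ Ioc A.a₁ A.a₂) (hy : 0 ≤ y) (hyx : y < g x) :
    A.followerBid (bidStrategy hg) y < A.bidOf g x := by
  by_contra! hle
  have h1 := F₁_le_winProbB hg hx hle
  have h2 := A.F₁_pos hx
  have h3 := lt_followerUtility_bidStrategy hg hx hy hyx
  rcases followerUtility_bidStrategy_le hg hy with ⟨-, h⟩ | ⟨z, hz, h, -, hu⟩
  · linarith
  · have hxz : x ≤ z := by
      rw [h] at h1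
      exact (A.F₁_strictMonoOn.le_iff_le (Ioc_subset_Icc_self hx) (Ioc_subset_Icc_self hz)).1 h1
    have h4 := hg.le_cumul_sub hx hxz hz.2
    nlinarith

/-- A lower bid yields zero or at most the value at some `z < x`. Since `g ≤ g x < y` on `(z, x]`,
the value at `x` is strictly larger. -/
lemma bidOf_le_followerBid {x y : ℝ} (hx : x ∈ Ioc A.a₁ A.a₂) (hy : 0 ≤ y) (hyx : g x < y) :
    A.bidOf g x ≤ A.followerBid (bidStrategy hg) y := by
  by_contra! hlt
  have h1 := le_followerUtility_bidStrategy hg hx hy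
  have h2 := A.F₁_pos hx
  have h3 := hg.bidOf_le hx
  have h4 : A.F₁ x * A.bidOf g x = A.cumul g x := IsAdmissible.F₁_mul_bidOf hx
  rcases followerUtility_bidStrategy_le hg hy with ⟨h, -⟩ | ⟨z, hz, -, hzt, hu⟩
  · nlinarith
  · have hzx : z < x := by
      by_contra! hxz
      exact hlt.not_ge ((hg.bidOf_monotoneOn hx hz hxz).trans hzt)
    have h5 := hg.cumul_sub_le hz.1.le hzx.le hx
    have h6 := A.F₁_strictMonoOn (Ioc_subset_Icc_self hz) (Ioc_subset_Icc_self hx) hzx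
    nlinarith

/-- Conjugating twice returns `cumul g`: the maximum of `F₁ x * y - u_B y` is `cumul g x`, attained
at `y = g x` and at no smaller `y`. -/
lemma equalBid_bidStrategy {x : ℝ} (hx : x ∈ Ioc A.a₁ A.a₂) :
    A.equalBid (bidStrategy hg) x = g x := by
  have hgx := hg.2.2 x hx
  have h1 : A.cumul g x ≤ A.F₁ x * g x - A.followerUtility (bidStrategy hg) (g x) := by
    rcases followerUtility_bidStrategy_le hg hgx.1 with ⟨h, -⟩ | ⟨z, hz, -, -, hu⟩
    · have := hg.bidOf_le hx
      rw [A.bidOf_eq g hx, div_le_iff₀ (A.F₁_pos hx)] at this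
      linarith
    · rcases le_total z x with h | h
      · have := hg.cumul_sub_le hz.1.le h hx
        nlinarith
      · have := hg.le_cumul_sub hx h hz.2
        nlinarith
  have hspec := (equalBid_spec (A := A) (bidStrategy hg) x).1
  have h2 := F₁_mul_smoothed (A := A) (bidStrategy hg) hx
  have h3 := le_followerUtility_bidStrategy hg hx hspec.1
  have h4 := le_F₁_mul_smoothed (A := A) (bidStrategy hg) hx hgx
  refine le_antisymm (equalBid_le_of_le _ hx hgx (by linarith)) ?_
  by_contra! hlt
  have h5 := lt_followerUtility_bidStrategy hg hx hspec.1 hlt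
  linarith

lemma measurePreserving_outcomeLaw (s : Kernel ℝ ℝ) [IsMarkovKernel s] :
    MeasurePreserving (fun p : (ℝ × ℝ) × ℝ => (p.1.1, p.2)) (A.outcomeLaw s)
      (A.leaderLaw.prod A.followerLaw) := by
  have h1 : MeasurePreserving (Prod.fst : ℝ × ℝ → ℝ) (A.leaderLaw.compProd s) A.leaderLaw :=
    ⟨measurable_fst, Measure.fst_compProd _ _⟩
  exact h1.prod (MeasurePreserving.id A.followerLaw)

/-- Off the null event `y = g x`, the leader wins exactly against the followers with `y < g x`; the
follower's bid at equality is never needed. -/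
lemma leaderPayoff_bidStrategy_ae : A.leaderPayoff (bidStrategy hg)
    =ᵐ[A.outcomeLaw (bidStrategy hg)] fun p => A.equalBidPayoff g (p.1.1, p.2) := by
  have hπ := (measurePreserving_outcomeLaw (A := A) (bidStrategy hg)).quasiMeasurePreserving
  have h1 : ∀ᵐ p ∂A.outcomeLaw (bidStrategy hg), p.1.1 ∈ Ioc A.a₁ A.a₂ :=
    hπ.ae (Measure.quasiMeasurePreserving_fst.ae A.ae_mem_Ioc)
  have h2 : ∀ᵐ p ∂A.outcomeLaw (bidStrategy hg), p.2 ∈ Icc A.b₁ A.b₂ :=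
    hπ.ae (Measure.quasiMeasurePreserving_snd.ae A.ae_mem_Icc_followerLaw)
  have h3 : ∀ᵐ p ∂A.outcomeLaw (bidStrategy hg), g p.1.1 ≠ p.2 := hπ.ae (ae_ne_prod hg.aemeasurable)
  have h4 : ∀ᵐ p ∂A.outcomeLaw (bidStrategy hg),
      p.1.2 = (Ioc A.a₁ A.a₂).indicator (A.bidOf g) p.1.1 := by
    refine Measure.quasiMeasurePreserving_fst.ae (p := fun p : ℝ × ℝ =>
      p.2 = (Ioc A.a₁ A.a₂).indicator (A.bidOf g) p.1) ?_
    refine Measure.ae_compProd_of_ae_ae (measurableSet_eq_fun measurable_snd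
      ((measurable_indicator_bidOf hg).comp measurable_fst)) (Eventually.of_forall fun x => ?_)
    rw [bidStrategy, Kernel.deterministic_apply]
    simp [ae_dirac_eq]
  filter_upwards [h1, h2, h3, h4] with p hx hy hne hb
  rw [indicator_of_mem hx] at hb
  have hy0 := A.b₁_nonneg.trans hy.1
  rw [leaderPayoff, equalBidPayoff, hb]
  rcases lt_or_gt_of_ne hne with h | h
  · rw [if_neg (bidOf_le_followerBid hg hx hy0 h).not_gt, if_neg (by simpa using h.le)]
  · rw [if_pos (followerBid_lt_bidOf hg hx hy0 h), if_pos (by simpa using h)]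

lemma isStrategy_bidStrategy : A.IsStrategy (bidStrategy hg) := by
  refine ⟨inferInstance, Integrable.congr ?_ (leaderPayoff_bidStrategy_ae hg).symm⟩
  have hπ := measurePreserving_outcomeLaw (A := A) (bidStrategy hg)
  exact hπ.integrable_comp_of_integrable (integrable_equalBidPayoff hg)

lemma leaderUtility_bidStrategy : A.leaderUtility (bidStrategy hg) = A.objective g := by
  have hπ := measurePreserving_outcomeLaw (A := A) (bidStrategy hg)
  rw [leaderUtility, integral_congr_ae (leaderPayoff_bidStrategy_ae hg),
    ← integral_equalBidPayoff hg, ← hπ.map_eq, integral_map hπ.measurable.aemeasurable]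
  rw [hπ.map_eq]
  exact (integrable_equalBidPayoff hg).aestronglyMeasurable

end BidStrategy

/-! ### The reduction to the optimization problem -/

lemma objective_congr {g h : ℝ → ℝ} (hgh : ∀ x ∈ Ioc A.a₁ A.a₂, g x = h x) :
    A.objective g = A.objective h := by
  rw [A.objective_eq, A.objective_eq]
  refine integral_congr_ae ?_
  filter_upwards [A.ae_mem_Ioc] with x hx
  have : A.cumul g x = A.cumul h x :=
    setIntegral_congr_fun measurableSet_Ioc fun t ht => hgh t ⟨ht.1, ht.2.trans hx.2⟩
  rw [A.bidOf_eq g hx, A.bidOf_eq h hx, this, hgh x hx]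

lemma IsAdmissible.congr {g h : ℝ → ℝ} (hg : A.IsAdmissible g)
    (hgh : ∀ x ∈ Ioc A.a₁ A.a₂, h x = g x) : A.IsAdmissible h := by
  refine ⟨hg.1.congr fun x hx => (hgh x hx).symm, fun x hx => ?_, fun x hx => ?_⟩
  · refine (hg.2.1 x hx).congr_of_eventuallyEq ?_ (hgh x hx)
    filter_upwards [Ioc_mem_nhdsLE hx.1] with t ht
    exact hgh t ⟨ht.1, ht.2.trans hx.2⟩
  · rw [hgh x hx]; exact hg.2.2 x hx

theorem isOptimalEqualBid_iff (g : ℝ → ℝ) : A.IsOptimalEqualBid g ↔ A.IsMaximizer g := by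
  constructor
  · rintro ⟨s, hs, hgs⟩
    have := hs.1.1
    refine ⟨(isAdmissible_equalBid s).congr hgs, fun h hh => ?_⟩
    rw [objective_congr hgs, ← leaderUtility_bidStrategy hh]
    exact (hs.2 _ (isStrategy_bidStrategy hh)).trans (leaderUtility_le_objective hs.1)
  · rintro ⟨hg, hmax⟩
    refine ⟨bidStrategy hg, ⟨isStrategy_bidStrategy hg, fun s hs => ?_⟩,
      fun x hx => (equalBid_bidStrategy hg hx).symm⟩
    have := hs.1
    rw [leaderUtility_bidStrategy]
    exact (leaderUtility_le_objective hs).trans (hmax _ (isAdmissible_equalBid s))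

/-! ### Existence of a maximizer -/

/-- Helly's selection theorem, with a left-continuous limit. -/
lemma exists_subseq_tendsto_of_monotone {G : ℕ → ℝ → ℝ} {b : ℝ} (hG : ∀ n, Monotone (G n))
    (hb : ∀ n x, G n x ∈ Icc 0 b) :
    ∃ φ : ℕ → ℕ, StrictMono φ ∧ ∃ g : ℝ → ℝ, Monotone g ∧ (∀ x, g x ∈ Icc 0 b) ∧
      (∀ x, ContinuousWithinAt g (Iic x) x) ∧
      ∀ x, ContinuousAt g x → Tendsto (fun n => G (φ n) x) atTop (𝓝 (g x)) := by
  -- Tychonoff gives convergence at all rationals along a subsequence. Taking the supremum of the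
  -- limits over the rationals strictly below `x` makes the limit left-continuous.
  obtain ⟨h, hh, φ, hφ, hlim⟩ :=
    (isCompact_univ_pi fun _ : ℚ => isCompact_Icc (a := (0 : ℝ)) (b := b)).tendsto_subseq
      (x := fun n (q : ℚ) => G n q) fun n q _ => hb n q
  rw [tendsto_pi_nhds] at hlim
  have hh : ∀ q, h q ∈ Icc 0 b := fun q => hh q (mem_univ q)
  have hbdd : ∀ x : ℝ, BddAbove (h '' {q : ℚ | (q : ℝ) < x}) := fun x =>
    ⟨b, by rintro _ ⟨q, -, rfl⟩; exact (hh q).2⟩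
  have hne : ∀ x : ℝ, (h '' {q : ℚ | (q : ℝ) < x}).Nonempty := fun x => by
    obtain ⟨q, hq⟩ := exists_rat_lt x
    exact ⟨h q, q, hq, rfl⟩
  have hle : ∀ {q : ℚ} {x : ℝ}, (q : ℝ) < x → h q ≤ sSup (h '' {q : ℚ | (q : ℝ) < x}) :=
    fun {q x} hq => le_csSup (hbdd x) ⟨q, hq, rfl⟩
  have hlt : ∀ {c x : ℝ}, c < sSup (h '' {q : ℚ | (q : ℝ) < x}) → ∃ q : ℚ, (q : ℝ) < x ∧ c < h q :=
    fun {c x} hc => by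
      obtain ⟨_, ⟨q, hq, rfl⟩, hcq⟩ := exists_lt_of_lt_csSup (hne x) hc
      exact ⟨q, hq, hcq⟩
  have hmono : Monotone fun x : ℝ => sSup (h '' {q : ℚ | (q : ℝ) < x}) := fun x y hxy =>
    csSup_le_csSup (hbdd y) (hne x) (image_mono fun q (hq : (q : ℝ) < x) => hq.trans_le hxy)
  refine ⟨φ, hφ, fun x => sSup (h '' {q : ℚ | (q : ℝ) < x}), hmono, fun x => ?_, fun x => ?_,
    fun x hx => ?_⟩
  · obtain ⟨q, hq⟩ := exists_rat_lt x
    refine ⟨(hh q).1.trans (hle hq), csSup_le (hne x) ?_⟩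
    rintro _ ⟨q, -, rfl⟩
    exact (hh q).2
  · refine tendsto_order.2 ⟨fun c hc => ?_, fun c hc => ?_⟩
    · obtain ⟨q, hq, hcq⟩ := hlt hc
      filter_upwards [mem_nhdsWithin_of_mem_nhds (Ioi_mem_nhds hq)] with t ht
      exact hcq.trans_le (hle ht)
    · filter_upwards [self_mem_nhdsWithin] with t ht
      exact (hmono ht).trans_lt hc
  · refine tendsto_order.2 ⟨fun c hc => ?_, fun c hc => ?_⟩
    · obtain ⟨q, hq, hcq⟩ := hlt hc
      filter_upwards [(hlim q).eventually (eventually_gt_nhds hcq)] with n hn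
      exact hn.trans_le (hG (φ n) hq.le)
    · have h1 : ∀ᶠ t in 𝓝[>] x, sSup (h '' {q : ℚ | (q : ℝ) < t}) < c :=
        (hx.eventually (eventually_lt_nhds hc)).filter_mono nhdsWithin_le_nhds
      obtain ⟨t, ht, hxt⟩ := (h1.and self_mem_nhdsWithin).exists
      obtain ⟨r, hxr, hrt⟩ := exists_rat_btwn hxt
      filter_upwards [(hlim r).eventually (eventually_lt_nhds ((hle hrt).trans_lt ht))] with n hn
      exact (hG (φ n) hxr.le).trans_lt hn

/-- The extension of a function on `(a₁, a₂]` by its extreme values. -/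
noncomputable def extend (A : FirstPriceAuction) (g : ℝ → ℝ) (x : ℝ) : ℝ :=
  if x ≤ A.a₁ then 0 else if x ≤ A.a₂ then g x else A.b₂

lemma extend_eq {g : ℝ → ℝ} {x : ℝ} (hx : x ∈ Ioc A.a₁ A.a₂) : A.extend g x = g x := by
  rw [extend, if_neg hx.1.not_ge, if_pos hx.2]

lemma IsAdmissible.extend_mem {g : ℝ → ℝ} (hg : A.IsAdmissible g) (x : ℝ) :
    A.extend g x ∈ Icc 0 A.b₂ := by
  unfold extend
  have := A.b₂_pos.le
  split_ifs with h1 h2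
  · exact ⟨le_rfl, this⟩
  · exact hg.2.2 x ⟨not_le.1 h1, h2⟩
  · exact ⟨this, le_rfl⟩

lemma IsAdmissible.monotone_extend {g : ℝ → ℝ} (hg : A.IsAdmissible g) :
    Monotone (A.extend g) := by
  intro x y hxy
  rcases le_or_gt x A.a₁ with h1 | h1
  · rw [extend, if_pos h1]; exact (hg.extend_mem y).1
  rcases le_or_gt y A.a₂ with h2 | h2
  · have hx : x ∈ Ioc A.a₁ A.a₂ := ⟨h1, hxy.trans h2⟩
    have hy : y ∈ Ioc A.a₁ A.a₂ := ⟨h1.trans_le hxy, h2⟩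
    rw [extend_eq hx, extend_eq hy]
    exact hg.1 hx hy hxy
  · rw [extend.eq_def A g y, if_neg (h1.trans_le hxy).not_ge, if_neg h2.not_ge]
    exact (hg.extend_mem x).2

lemma exists_subseq_tendsto_ae {G : ℕ → ℝ → ℝ} (hG : ∀ n, A.IsAdmissible (G n)) :
    ∃ φ : ℕ → ℕ, StrictMono φ ∧ ∃ g : ℝ → ℝ, A.IsAdmissible g ∧
      ∀ᵐ x ∂A.leaderLaw, Tendsto (fun n => G (φ n) x) atTop (𝓝 (g x)) := by
  obtain ⟨φ, hφ, g, hmono, hmem, hcont, hlim⟩ := exists_subseq_tendsto_of_monotone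
    (fun n => (hG n).monotone_extend) fun n => (hG n).extend_mem
  refine ⟨φ, hφ, g, ⟨hmono.monotoneOn _, fun x _ => hcont x, fun x _ => hmem x⟩, ?_⟩
  have hae : ∀ᵐ x ∂A.leaderLaw, ContinuousAt g x :=
    hmono.countable_not_continuousAt.measure_zero _
  filter_upwards [A.ae_mem_Ioc, hae] with x hx hxc
  simpa only [extend_eq hx] using hlim x hxc

lemma tendsto_bidOf {G : ℕ → ℝ → ℝ} {g : ℝ → ℝ} (hG : ∀ n, A.IsAdmissible (G n))
    (hlim : ∀ᵐ x ∂A.leaderLaw, Tendsto (fun n => G n x) atTop (𝓝 (g x))) {x : ℝ}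
    (hx : x ∈ Ioc A.a₁ A.a₂) :
    Tendsto (fun n => A.bidOf (G n) x) atTop (𝓝 (A.bidOf g x)) := by
  simp only [A.bidOf_eq _ hx]
  refine Tendsto.div_const ?_ _
  refine tendsto_integral_of_dominated_convergence (fun _ => A.b₂)
    (fun n => (hG n).integrable.integrableOn.aestronglyMeasurable) (integrable_const _)
    (fun n => ?_) (ae_restrict_of_ae hlim)
  refine ae_restrict_of_ae ((hG n).ae_mem.mono fun t ht => ?_)
  rw [Real.norm_eq_abs, abs_of_nonneg ht.1]
  exact ht.2

lemma IsAdmissible.aemeasurable_F₂ {g : ℝ → ℝ} (hg : A.IsAdmissible g) :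
    AEMeasurable (fun x => A.F₂ (g x)) A.leaderLaw :=
  A.F₂_mono.measurable.comp_aemeasurable hg.aemeasurable

lemma IsAdmissible.abs_sub_bidOf_le {g : ℝ → ℝ} (hg : A.IsAdmissible g) {x : ℝ}
    (hx : x ∈ Ioc A.a₁ A.a₂) : |x - A.bidOf g x| ≤ A.a₂ + A.b₂ := by
  have h1 := hg.bidOf_nonneg hx
  have h2 := (hg.bidOf_le hx).trans (hg.2.2 x hx).2
  have := A.a₁_nonneg
  rw [_root_.abs_le]
  constructor <;> linarith [hx.1, hx.2, A.b₂_pos]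

lemma IsAdmissible.abs_objective_integrand_le {g : ℝ → ℝ} (hg : A.IsAdmissible g) {x : ℝ}
    (hx : x ∈ Ioc A.a₁ A.a₂) : |(x - A.bidOf g x) * A.F₂ (g x)| ≤ A.a₂ + A.b₂ := by
  rw [abs_mul, abs_of_nonneg (A.F₂_nonneg _)]
  have h1 := hg.abs_sub_bidOf_le hx
  have h2 := A.F₂_le_one (g x)
  have h3 := A.F₂_nonneg (g x)
  nlinarith [abs_nonneg (x - A.bidOf g x)]

lemma IsAdmissible.aemeasurable_objective_integrand {g : ℝ → ℝ} (hg : A.IsAdmissible g) :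
    AEMeasurable (fun x => (x - A.bidOf g x) * A.F₂ (g x)) A.leaderLaw :=
  (aemeasurable_id.sub (aemeasurable_bidOf hg.integrable)).mul hg.aemeasurable_F₂

lemma IsAdmissible.integrable_objective_integrand {g : ℝ → ℝ} (hg : A.IsAdmissible g) :
    Integrable (fun x => (x - A.bidOf g x) * A.F₂ (g x)) A.leaderLaw :=
  integrable_of_ae_abs_le hg.aemeasurable_objective_integrand
    (A.ae_mem_Ioc.mono fun _ hx => hg.abs_objective_integrand_le hx)

lemma tendsto_objective {G : ℕ → ℝ → ℝ} {g : ℝ → ℝ} (hG : ∀ n, A.IsAdmissible (G n))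
    (hg : A.IsAdmissible g)
    (hlim : ∀ᵐ x ∂A.leaderLaw, Tendsto (fun n => G n x) atTop (𝓝 (g x))) :
    Tendsto (fun n => A.objective (G n)) atTop (𝓝 (A.objective g)) := by
  simp only [A.objective_eq]
  refine tendsto_integral_of_dominated_convergence (fun _ => A.a₂ + A.b₂)
    (fun n => (hG n).aemeasurable_objective_integrand.aestronglyMeasurable) (integrable_const _)
    (fun n => A.ae_mem_Ioc.mono fun x hx => (hG n).abs_objective_integrand_le hx) ?_
  filter_upwards [A.ae_mem_Ioc, hlim] with x hx hxl
  refine (tendsto_const_nhds.sub (tendsto_bidOf hG hlim hx)).mul ?_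
  exact (A.F₂_continuousOn (g x) (hg.2.2 x hx).2).tendsto.comp (tendsto_nhdsWithin_iff.2
    ⟨hxl, Eventually.of_forall fun n => ((hG n).2.2 x hx).2⟩)

lemma isAdmissible_const {c : ℝ} (hc : c ∈ Icc 0 A.b₂) : A.IsAdmissible fun _ => c :=
  ⟨monotoneOn_const, fun _ _ => continuousWithinAt_const, fun _ _ => hc⟩

/-- A maximizing sequence has a subsequence converging almost everywhere to an admissible function,
and the objective is continuous along it. -/
theorem exists_isMaximizer : ∃ g, A.IsMaximizer g := by
  have hne : (A.objective '' {g | A.IsAdmissible g}).Nonempty :=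
    ⟨_, _, isAdmissible_const (left_mem_Icc.2 A.b₂_pos.le), rfl⟩
  have hbdd : BddAbove (A.objective '' {g | A.IsAdmissible g}) := by
    refine ⟨A.a₂ + A.b₂, ?_⟩
    rintro _ ⟨g, hg, rfl⟩
    have hg : A.IsAdmissible g := hg
    rw [A.objective_eq]
    have := integral_mono_ae hg.integrable_objective_integrand (integrable_const (A.a₂ + A.b₂))
      (A.ae_mem_Ioc.mono fun x hx => (le_abs_self _).trans (hg.abs_objective_integrand_le hx))
    simpa using this
  obtain ⟨v, -, hv, hmem⟩ := exists_seq_tendsto_sSup hne hbdd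
  choose G hG hGv using hmem
  obtain ⟨φ, hφ, g, hg, hlim⟩ := exists_subseq_tendsto_ae hG
  refine ⟨g, hg, fun h hh => ?_⟩
  have h1 := tendsto_objective (fun n => hG (φ n)) hg hlim
  simp only [hGv] at h1
  rw [tendsto_nhds_unique h1 (hv.comp hφ.tendsto_atTop)]
  exact le_csSup hbdd ⟨h, hh, rfl⟩

/-! ### The first-order condition -/

/-- The marginal cost of the bids above `t`: the expected value of `F₂(g) / F₁` on `(t, a₂]`. -/
noncomputable def tailWeight (A : FirstPriceAuction) (g : ℝ → ℝ) (t : ℝ) : ℝ :=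
  ∫ x in Ioc t A.a₂, A.F₂ (g x) / A.F₁ x ∂A.leaderLaw

/-- The derivative of the objective with respect to `g x`, where `b₁ ≤ g x`, up to scaling. -/
noncomputable def marginal (A : FirstPriceAuction) (g : ℝ → ℝ) (x : ℝ) : ℝ :=
  x - A.bidOf g x - (A.b₂ - A.b₁) * A.tailWeight g x

lemma aemeasurable_F₁ : AEMeasurable A.F₁ A.leaderLaw := by
  have := (A.F₁_continuousOn.mono Ioc_subset_Icc_self).aemeasurable (μ := A.leaderLaw)
    measurableSet_Ioc
  rwa [A.restrict_leaderLaw] at this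

lemma integrableOn_div_F₁ {k : ℝ → ℝ} (hk : AEMeasurable k A.leaderLaw) {C : ℝ}
    (hC : ∀ x ∈ Ioc A.a₁ A.a₂, |k x| ≤ C) {c : ℝ} (hc : c ∈ Ioc A.a₁ A.a₂) :
    IntegrableOn (fun x => k x / A.F₁ x) (Ioc c A.a₂) A.leaderLaw := by
  refine Integrable.of_bound (hk.div aemeasurable_F₁).restrict.aestronglyMeasurable (C / A.F₁ c) ?_
  filter_upwards [ae_restrict_mem measurableSet_Ioc] with x hx
  have hx' : x ∈ Ioc A.a₁ A.a₂ := ⟨hc.1.trans hx.1, hx.2⟩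
  rw [Real.norm_eq_abs, abs_div, abs_of_pos (A.F₁_pos hx')]
  exact div_le_div₀ ((abs_nonneg _).trans (hC x hx')) (hC x hx') (A.F₁_pos hc)
    (A.F₁_strictMonoOn (Ioc_subset_Icc_self hc) (Ioc_subset_Icc_self hx') hx.1).le

/-- Fubini turns the effect of a variation `k` on all bids into a weight at each single valuation,
which gives the gradient of the payment term. -/
lemma integral_bidOf_mul {g k : ℝ → ℝ} (hg : A.IsAdmissible g) (hk : AEMeasurable k A.leaderLaw)
    {C : ℝ} (hC : ∀ x ∈ Ioc A.a₁ A.a₂, |k x| ≤ C) :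
    Integrable (fun t => k t * A.tailWeight g t) A.leaderLaw ∧
      ∫ x, A.bidOf k x * A.F₂ (g x) ∂A.leaderLaw =
        ∫ t, k t * A.tailWeight g t ∂A.leaderLaw := by
  have hC0 : 0 ≤ C := (abs_nonneg _).trans (hC A.a₂ (right_mem_Ioc.2 A.a₁_lt_a₂))
  set K : ℝ × ℝ → ℝ := ({z : ℝ × ℝ | z.2 ≤ z.1}).indicator
    fun z => k z.2 * (A.F₂ (g z.1) / A.F₁ z.1) with hK
  have hS : MeasurableSet {z : ℝ × ℝ | z.2 ≤ z.1} := measurableSet_le measurable_snd measurable_fst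
  have hmeas : AEStronglyMeasurable K (A.leaderLaw.prod A.leaderLaw) :=
    (hk.comp_snd.mul (hg.aemeasurable_F₂.div aemeasurable_F₁).comp_fst).aestronglyMeasurable.indicator
      hS
  have hsec : ∀ x, (fun t => K (x, t)) =
      (Iic x).indicator fun t => k t * (A.F₂ (g x) / A.F₁ x) := fun x => by
    ext t; simp [hK, indicator]
  have hkint : Integrable k A.leaderLaw :=
    integrable_of_ae_abs_le hk (A.ae_mem_Ioc.mono hC)
  have hIic : ∀ x : ℝ, Iic x =ᵐ[A.leaderLaw] Ioc A.a₁ x := fun x => by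
    filter_upwards [A.ae_mem_Ioc] with t ht
    exact propext ⟨fun h => ⟨ht.1, h⟩, fun h => h.2⟩
  have hsect : ∀ (l : ℝ → ℝ) (x : ℝ), x ∈ Ioc A.a₁ A.a₂ →
      ∫ t, (Iic x).indicator (fun t => l t * (A.F₂ (g x) / A.F₁ x)) t ∂A.leaderLaw =
        A.bidOf l x * A.F₂ (g x) := fun l x hx => by
    rw [integral_indicator measurableSet_Iic, setIntegral_congr_set (hIic x), integral_mul_const,
      A.bidOf_eq l hx, cumul]
    ring
  have hint : Integrable K (A.leaderLaw.prod A.leaderLaw) := by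
    -- The factor `1 / F₁` is singular at `a₁`. Integrating in `t` first cancels it, because an
    -- average of `|k|` is at most `C`.
    refine (integrable_prod_iff hmeas).2 ⟨Eventually.of_forall fun x => ?_, ?_⟩
    · rw [hsec]
      exact (hkint.mul_const _).indicator measurableSet_Iic
    · refine Integrable.of_bound hmeas.norm.integral_prod_right' C ?_
      filter_upwards [A.ae_mem_Ioc] with x hx
      have h1 : (fun t => ‖K (x, t)‖) =
          (Iic x).indicator fun t => |k t| * (A.F₂ (g x) / A.F₁ x) := by
        ext t
        rw [show K (x, t) = _ from congr_fun (hsec x) t, norm_indicator_eq_indicator_norm]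
        congr 1 with t
        rw [Real.norm_eq_abs, abs_mul, abs_of_nonneg (div_nonneg (A.F₂_nonneg _) (A.F₁_pos hx).le)]
      rw [h1, hsect (fun t => |k t|) x hx, Real.norm_eq_abs, abs_mul, abs_of_nonneg (A.F₂_nonneg _)]
      have h2 := abs_bidOf_le (g := fun t => |k t|) hkint.abs (C := C)
        (fun x hx => by rw [abs_abs]; exact hC x hx) hx
      have h3 := A.F₂_le_one (g x)
      have h4 := A.F₂_nonneg (g x)
      nlinarith
  have hright : ∀ t, ∫ x, K (x, t) ∂A.leaderLaw = k t * A.tailWeight g t := fun t => by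
    have h1 : (fun x => K (x, t)) =
        (Ici t).indicator fun x => k t * (A.F₂ (g x) / A.F₁ x) := by
      ext x; simp [hK, indicator]
    have h2 : Ici t =ᵐ[A.leaderLaw] Ioc t A.a₂ := by
      refine Ioi_ae_eq_Ici.symm.trans ?_
      filter_upwards [A.ae_mem_Ioc] with x hx
      exact propext ⟨fun h => ⟨h, hx.2⟩, fun h => h.1⟩
    rw [h1, integral_indicator measurableSet_Ici, setIntegral_congr_set h2, integral_const_mul]
    rfl
  have hr : Integrable (fun t => ∫ x, K (x, t) ∂A.leaderLaw) A.leaderLaw := hint.integral_prod_right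
  simp only [hright] at hr
  refine ⟨hr, ?_⟩
  calc ∫ x, A.bidOf k x * A.F₂ (g x) ∂A.leaderLaw
      = ∫ x, ∫ t, K (x, t) ∂A.leaderLaw ∂A.leaderLaw := by
        refine integral_congr_ae ?_
        filter_upwards [A.ae_mem_Ioc] with x hx
        rw [hsec, hsect k x hx]
    _ = ∫ t, ∫ x, K (x, t) ∂A.leaderLaw ∂A.leaderLaw :=
        integral_integral_swap (f := fun x t => K (x, t)) hint
    _ = _ := by simp only [hright]

lemma IsAdmissible.combo {g h : ℝ → ℝ} (hg : A.IsAdmissible g) (hh : A.IsAdmissible h) {ε : ℝ}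
    (hε : ε ∈ Icc (0 : ℝ) 1) : A.IsAdmissible fun x => (1 - ε) * g x + ε * h x := by
  have h1 : 0 ≤ 1 - ε := sub_nonneg.2 hε.2
  refine ⟨fun x hx y hy hxy => ?_, fun x hx => ?_, fun x hx => ⟨?_, ?_⟩⟩
  · exact add_le_add (mul_le_mul_of_nonneg_left (hg.1 hx hy hxy) h1)
      (mul_le_mul_of_nonneg_left (hh.1 hx hy hxy) hε.1)
  · exact (continuousWithinAt_const.mul (hg.2.1 x hx)).add
      (continuousWithinAt_const.mul (hh.2.1 x hx))
  · exact add_nonneg (mul_nonneg h1 (hg.2.2 x hx).1) (mul_nonneg hε.1 (hh.2.2 x hx).1)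
  · have := mul_le_mul_of_nonneg_left (hg.2.2 x hx).2 h1
    have := mul_le_mul_of_nonneg_left (hh.2.2 x hx).2 hε.1
    linarith

lemma bidOf_combo {g h : ℝ → ℝ} (hg : Integrable g A.leaderLaw) (hh : Integrable h A.leaderLaw)
    (a b : ℝ) {x : ℝ} (hx : x ∈ Ioc A.a₁ A.a₂) :
    A.bidOf (fun x => a * g x + b * h x) x = a * A.bidOf g x + b * A.bidOf h x := by
  rw [A.bidOf_eq _ hx, A.bidOf_eq _ hx, A.bidOf_eq _ hx, cumul,
    integral_add (hg.integrableOn.const_mul a) (hh.integrableOn.const_mul b), integral_const_mul,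
    integral_const_mul, cumul, cumul]
  ring

/-- The first-order condition, in a direction in which the objective is quadratic. -/
lemma IsMaximizer.integral_variation_nonpos {g h : ℝ → ℝ} (hg : A.IsMaximizer g)
    (hh : A.IsAdmissible h)
    (hF : ∀ x ∈ Ioc A.a₁ A.a₂, ∀ ε ∈ Icc (0 : ℝ) 1,
      A.F₂ ((1 - ε) * g x + ε * h x) = (1 - ε) * A.F₂ (g x) + ε * A.F₂ (h x)) :
    Integrable (fun x => (x - A.bidOf g x) * (A.F₂ (h x) - A.F₂ (g x)) -
      (h x - g x) * A.tailWeight g x) A.leaderLaw ∧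
    ∫ x, ((x - A.bidOf g x) * (A.F₂ (h x) - A.F₂ (g x)) -
      (h x - g x) * A.tailWeight g x) ∂A.leaderLaw ≤ 0 := by
  have hga := hg.1
  have hk : AEMeasurable (fun x => h x - g x) A.leaderLaw := hh.aemeasurable.sub hga.aemeasurable
  have hkb : ∀ x ∈ Ioc A.a₁ A.a₂, |h x - g x| ≤ A.b₂ := fun x hx =>
    abs_sub_le_of_nonneg_of_le (hh.2.2 x hx).1 (hh.2.2 x hx).2 (hga.2.2 x hx).1 (hga.2.2 x hx).2
  have hki : Integrable (fun x => h x - g x) A.leaderLaw := hh.integrable.sub hga.integrable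
  obtain ⟨hi2, he2⟩ := integral_bidOf_mul hga hk hkb
  have hFm := hh.aemeasurable_F₂.sub hga.aemeasurable_F₂
  have hFb : ∀ x, |A.F₂ (h x) - A.F₂ (g x)| ≤ 1 := fun x =>
    abs_sub_le_of_nonneg_of_le (A.F₂_nonneg _) (A.F₂_le_one _) (A.F₂_nonneg _) (A.F₂_le_one _)
  have hi1 : Integrable (fun x => (x - A.bidOf g x) * (A.F₂ (h x) - A.F₂ (g x))) A.leaderLaw := by
    refine integrable_of_ae_abs_le
      ((aemeasurable_id.sub (aemeasurable_bidOf hga.integrable)).mul hFm) (C := A.a₂ + A.b₂) ?_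
    filter_upwards [A.ae_mem_Ioc] with x hx
    rw [abs_mul]
    have h1 := hga.abs_sub_bidOf_le hx
    have h2 := hFb x
    nlinarith [abs_nonneg (x - A.bidOf g x), abs_nonneg (A.F₂ (h x) - A.F₂ (g x))]
  have hbm := aemeasurable_bidOf hki
  have hi3 : Integrable (fun x => A.bidOf (fun x => h x - g x) x * A.F₂ (g x)) A.leaderLaw := by
    refine integrable_of_ae_abs_le (hbm.mul hga.aemeasurable_F₂) (C := A.b₂) ?_
    filter_upwards [A.ae_mem_Ioc] with x hx
    rw [abs_mul, abs_of_nonneg (A.F₂_nonneg _)]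
    have h1 := abs_bidOf_le hki hkb hx
    have h2 := A.F₂_le_one (g x)
    have h3 := A.F₂_nonneg (g x)
    nlinarith [abs_nonneg (A.bidOf (fun x => h x - g x) x)]
  have hi4 : Integrable (fun x => A.bidOf (fun x => h x - g x) x * (A.F₂ (h x) - A.F₂ (g x)))
      A.leaderLaw := by
    refine integrable_of_ae_abs_le (hbm.mul hFm) (C := A.b₂) ?_
    filter_upwards [A.ae_mem_Ioc] with x hx
    rw [abs_mul]
    have h1 := abs_bidOf_le hki hkb hx
    have h2 := hFb x
    nlinarith [abs_nonneg (A.bidOf (fun x => h x - g x) x), abs_nonneg (A.F₂ (h x) - A.F₂ (g x))]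
  refine ⟨hi1.sub hi2, ?_⟩
  rw [integral_sub hi1 hi2, ← he2]
  set a := ∫ x, (x - A.bidOf g x) * (A.F₂ (h x) - A.F₂ (g x)) ∂A.leaderLaw -
    ∫ x, A.bidOf (fun x => h x - g x) x * A.F₂ (g x) ∂A.leaderLaw with ha
  set b := ∫ x, A.bidOf (fun x => h x - g x) x * (A.F₂ (h x) - A.F₂ (g x)) ∂A.leaderLaw with hb
  have key : ∀ ε ∈ Icc (0 : ℝ) 1, A.objective (fun x => (1 - ε) * g x + ε * h x) =
      A.objective g + ε * a - ε ^ 2 * b := by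
    intro ε hε
    have hi5 : Integrable (fun x => ε * ((x - A.bidOf g x) * (A.F₂ (h x) - A.F₂ (g x))) -
        ε * (A.bidOf (fun x => h x - g x) x * A.F₂ (g x))) A.leaderLaw :=
      (hi1.const_mul ε).sub (hi3.const_mul ε)
    have hi6 : Integrable (fun x => (x - A.bidOf g x) * A.F₂ (g x) +
        (ε * ((x - A.bidOf g x) * (A.F₂ (h x) - A.F₂ (g x))) -
        ε * (A.bidOf (fun x => h x - g x) x * A.F₂ (g x)))) A.leaderLaw :=
      hga.integrable_objective_integrand.add hi5
    rw [A.objective_eq, A.objective_eq, ha, hb, mul_sub, ← integral_const_mul, ← integral_const_mul,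
      ← integral_const_mul, ← integral_sub (hi1.const_mul ε) (hi3.const_mul ε),
      ← integral_add hga.integrable_objective_integrand hi5, ← integral_sub hi6 (hi4.const_mul _)]
    refine integral_congr_ae ?_
    filter_upwards [A.ae_mem_Ioc] with x hx
    have h1 : A.bidOf (fun x => h x - g x) x = A.bidOf h x - A.bidOf g x := by
      have := bidOf_combo hh.integrable hga.integrable 1 (-1) hx
      simpa [sub_eq_add_neg] using this
    rw [bidOf_combo hga.integrable hh.integrable _ _ hx, hF x hx ε hε, h1]
    ring
  by_contra! hpos
  -- This step size makes `ε * b < a`, so a positive linear coefficient `a` beats the quadratic term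
  -- and contradicts maximality.
  have hε0 : 0 < a / (a + |b|) := div_pos hpos (by positivity)
  have hε1 : a / (a + |b|) ≤ 1 := (div_le_one (by positivity)).2 (by linarith [abs_nonneg b])
  have hle := hg.2 _ (hga.combo hh ⟨hε0.le, hε1⟩)
  rw [key _ ⟨hε0.le, hε1⟩] at hle
  have hlt : a / (a + |b|) * b < a := by
    have h1 : a / (a + |b|) * (a + |b|) = a := div_mul_cancel₀ _ (by positivity)
    have h2 := le_abs_self b
    nlinarith
  nlinarith

/-- By left-continuity, a difference at one point persists on an interval to its left, which has
positive mass because the support is full. -/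
lemma ae_imp_eqOn {g h : ℝ → ℝ} (hg : A.IsAdmissible g) (hh : A.IsAdmissible h) {z : ℝ}
    (hz : z ≤ A.a₂) (hae : ∀ᵐ x ∂A.leaderLaw, x ≤ z → h x = g x) :
    ∀ x ∈ Ioc A.a₁ z, h x = g x := by
  intro x hx
  by_contra hne
  have hx' : x ∈ Ioc A.a₁ A.a₂ := ⟨hx.1, hx.2.trans hz⟩
  have h1 : ∀ᶠ t in 𝓝[<] x, h t ≠ g t :=
    (((hh.2.1 x hx').prodMk (hg.2.1 x hx')).eventually
      (isOpen_ne_fun continuous_fst continuous_snd |>.mem_nhds hne)).filter_mono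
      (nhdsWithin_mono _ Iio_subset_Iic_self)
  obtain ⟨c, hc, hcx⟩ := (mem_nhdsLT_iff_exists_Ioo_subset' hx.1).1 h1
  set d := max c A.a₁ with hd
  have hdx : d < x := max_lt hc hx.1
  have hpos : 0 < A.leaderLaw.real (Ioc d x) := by
    rw [A.leaderLaw_real_Ioc (le_max_right _ _) hdx.le hx'.2, sub_pos]
    exact A.F₁_strictMonoOn ⟨le_max_right _ _, hdx.le.trans hx'.2⟩ (Ioc_subset_Icc_self hx') hdx
  refine hpos.ne' ((measureReal_eq_zero_iff).2 (measure_mono_null ?_ hae))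
  intro t ht
  rcases eq_or_lt_of_le ht.2 with rfl | htx
  · exact fun hh => hne (hh hx.2)
  · exact fun hh => hcx ⟨(le_max_left _ _).trans_lt ht.1, htx⟩ (hh (ht.2.trans hx.2))

/-- A maximizer agrees with every admissible function that deviates from it only in the direction
of the marginal. -/
lemma IsMaximizer.eq_of_marginal {g h : ℝ → ℝ} (hg : A.IsMaximizer g) (hh : A.IsAdmissible h)
    (hgh : ∀ x ∈ Ioc A.a₁ A.a₂, h x = g x ∨ A.b₁ ≤ g x ∧ A.b₁ ≤ h x)
    (hsign : ∀ᵐ x ∂A.leaderLaw, 0 ≤ (h x - g x) * A.marginal g x)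
    (hzero : ∀ᵐ x ∂A.leaderLaw, h x ≠ g x → A.marginal g x ≠ 0) :
    ∀ x ∈ Ioc A.a₁ A.a₂, h x = g x := by
  have hb : 0 < A.b₂ - A.b₁ := sub_pos.2 A.b₁_lt_b₂
  have haff : ∀ y, A.b₁ ≤ y → y ≤ A.b₂ → A.F₂ y = (y - A.b₁) / (A.b₂ - A.b₁) := fun y h1 h2 => by
    rw [A.F₂_eq h2, max_eq_right (sub_nonneg.2 h1)]
  obtain ⟨hint, hle⟩ := hg.integral_variation_nonpos hh fun x hx ε hε => by
    rcases hgh x hx with h | ⟨h1, h2⟩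
    · rw [h, ← add_mul, ← add_mul]; simp
    · have h0 : 0 ≤ 1 - ε := sub_nonneg.2 hε.2
      have hg2 := (hg.1.2.2 x hx).2
      have hh2 := (hh.2.2 x hx).2
      rw [haff _ h1 hg2, haff _ h2 hh2, haff]
      · field_simp; ring
      · nlinarith [hε.1]
      · nlinarith [hε.1]
  -- Above `b₁` the slope of `F₂` is `1 / (b₂ - b₁)`; where `h = g` both sides vanish, so the kink
  -- of `F₂` at `b₁` is never crossed.
  have heq : (fun x => (x - A.bidOf g x) * (A.F₂ (h x) - A.F₂ (g x)) -
      (h x - g x) * A.tailWeight g x) =ᵐ[A.leaderLaw]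
      fun x => (h x - g x) * A.marginal g x / (A.b₂ - A.b₁) := by
    filter_upwards [A.ae_mem_Ioc] with x hx
    rcases hgh x hx with h | ⟨h1, h2⟩
    · rw [h]; simp
    · rw [haff _ h1 (hg.1.2.2 x hx).2, haff _ h2 (hh.2.2 x hx).2, marginal]
      field_simp
      ring
  rw [integral_congr_ae heq] at hle
  have hnn : 0 ≤ᵐ[A.leaderLaw] fun x => (h x - g x) * A.marginal g x / (A.b₂ - A.b₁) :=
    hsign.mono fun x hx => div_nonneg hx hb.le
  have hz := (integral_eq_zero_iff_of_nonneg_ae hnn (hint.congr heq)).1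
    (le_antisymm hle (integral_nonneg_of_ae hnn))
  refine ae_imp_eqOn hg.1 hh le_rfl ?_
  filter_upwards [hz, hzero] with x h1 h2 _
  by_contra hne
  have h1 : (h x - g x) * A.marginal g x / (A.b₂ - A.b₁) = 0 := h1
  exact (div_ne_zero (mul_ne_zero (sub_ne_zero.2 hne) (h2 hne)) hb.ne') h1

/-! ### The structure of the maximizers -/

open Classical in
lemma IsAdmissible.ite_le {g h : ℝ → ℝ} (hg : A.IsAdmissible g) (hh : A.IsAdmissible h) {c : ℝ}
    (hgh : ∀ x ∈ Ioc A.a₁ A.a₂, ∀ y ∈ Ioc A.a₁ A.a₂, x ≤ c → c < y → g x ≤ h y) :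
    A.IsAdmissible fun x => if x ≤ c then g x else h x := by
  refine ⟨fun x hx y hy hxy => ?_, fun x hx => ?_, fun x hx => ?_⟩
  · dsimp only
    split_ifs with h1 h2 h2
    · exact hg.1 hx hy hxy
    · exact hgh x hx y hy h1 (not_le.1 h2)
    · exact absurd (hxy.trans h2) h1
    · exact hh.1 hx hy hxy
  · rcases le_or_gt x c with h | h
    · refine (hg.2.1 x hx).congr (fun t ht => if_pos (le_trans ht h)) (if_pos h)
    · refine (hh.2.1 x hx).congr_of_eventuallyEq ?_ (if_neg h.not_ge)
      filter_upwards [mem_nhdsWithin_of_mem_nhds (Ioi_mem_nhds h)] with t ht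
      exact if_neg (not_le.2 ht)
  · dsimp only
    split_ifs
    · exact hg.2.2 x hx
    · exact hh.2.2 x hx

/-- Sublevel sets are initial intervals, closed on the right by left-continuity. Inserting `a₁`
makes the supremum meaningful when the set is empty. -/
lemma IsAdmissible.exists_le_iff {g : ℝ → ℝ} (hg : A.IsAdmissible g) (b : ℝ) :
    ∃ c ∈ Icc A.a₁ A.a₂, ∀ x ∈ Ioc A.a₁ A.a₂, g x ≤ b ↔ x ≤ c := by
  set S := insert A.a₁ {x ∈ Ioc A.a₁ A.a₂ | g x ≤ b} with hS
  have hub : ∀ x ∈ S, x ≤ A.a₂ := by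
    rintro x (rfl | hx)
    · exact A.a₁_lt_a₂.le
    · exact hx.1.2
  have hbdd : BddAbove S := ⟨A.a₂, hub⟩
  have ha : A.a₁ ∈ S := mem_insert _ _
  refine ⟨sSup S, ⟨le_csSup hbdd ha, csSup_le ⟨_, ha⟩ hub⟩, fun x hx =>
    ⟨fun h => le_csSup hbdd (mem_insert_of_mem _ ⟨hx, h⟩), fun h => ?_⟩⟩
  by_contra! hlt
  obtain ⟨d, hd, hdx, hdg⟩ := hg.exists_lt hx hlt
  obtain ⟨z, hz, hdz⟩ := exists_lt_of_lt_csSup ⟨_, ha⟩ (hdx.trans_le h)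
  rcases hz with rfl | hz
  · exact hd.not_gt hdz
  · exact hz.2.not_gt ((hdg d (left_mem_Icc.2 hdx.le)).trans_le
      (hg.1 ⟨hd, hdx.le.trans hx.2⟩ hz.1 hdz.le))

/-- Take the step from `0` to `b₂` at a point `c` close to `a₂`: above `c` the bid is at most `b₂ *
(1 - F₁ c) / F₁ c`, which tends to `0`, while the valuation tends to `a₂ > 0`. -/
lemma exists_objective_pos : ∃ g, A.IsAdmissible g ∧ 0 < A.objective g := by
  have ha2 : 0 < A.a₂ := A.a₁_nonneg.trans_lt A.a₁_lt_a₂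
  have hb := A.b₂_pos
  have hlim : Tendsto (fun c => c - A.b₂ * (1 - A.F₁ c) / A.F₁ c) (𝓝[<] A.a₂) (𝓝 A.a₂) := by
    have hF := tendsto_F₁_nhdsLT (A := A) (right_mem_Ioc.2 A.a₁_lt_a₂)
    rw [F₁_right] at hF
    have hid : Tendsto (fun c : ℝ => c) (𝓝[<] A.a₂) (𝓝 A.a₂) := nhdsWithin_le_nhds
    simpa using hid.sub ((((tendsto_const_nhds (x := (1 : ℝ))).sub hF).const_mul A.b₂).div hF one_ne_zero)
  obtain ⟨c, hpos, hc⟩ := ((hlim.eventually (eventually_gt_nhds ha2)).and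
    (Ioo_mem_nhdsLT A.a₁_lt_a₂)).exists
  have hc' : c ∈ Ioc A.a₁ A.a₂ := ⟨hc.1, hc.2.le⟩
  classical
  have hg := (isAdmissible_const (left_mem_Icc.2 hb.le)).ite_le (c := c)
    (isAdmissible_const (A := A) (right_mem_Icc.2 hb.le)) fun _ _ _ _ _ _ => hb.le
  refine ⟨_, hg, ?_⟩
  set g : ℝ → ℝ := fun x => if x ≤ c then 0 else A.b₂ with hgdef
  set m := c - A.b₂ * (1 - A.F₁ c) / A.F₁ c with hm
  have h0 : ∀ x ≤ c, A.cumul g x = 0 := fun x hx => by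
    rw [cumul, setIntegral_congr_fun (g := fun _ => 0) measurableSet_Ioc fun t ht =>
      if_pos (ht.2.trans hx)]
    simp
  have hF2 : A.F₂ A.b₂ = 1 := by
    have := A.b₁_lt_b₂
    rw [A.F₂_eq le_rfl, max_eq_right (by linarith), div_self (by linarith)]
  have hF0 : A.F₂ 0 = 0 := by
    have := A.b₁_nonneg
    rw [A.F₂_eq hb.le, max_eq_left (by linarith), zero_div]
  have hle : ∀ᵐ x ∂A.leaderLaw,
      (Ioc c A.a₂).indicator (fun _ => m) x ≤ (x - A.bidOf g x) * A.F₂ (g x) := by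
    filter_upwards [A.ae_mem_Ioc] with x hx
    rcases le_or_gt x c with h | h
    · rw [indicator_of_notMem (fun h' : x ∈ Ioc c A.a₂ => h'.1.not_ge h), hgdef]
      simp [h, hF0]
    · have hgx : g x = A.b₂ := if_neg h.not_ge
      rw [indicator_of_mem (show x ∈ Ioc c A.a₂ from ⟨h, hx.2⟩), hgx, hF2, mul_one, hm, A.bidOf_eq g hx]
      have h1 := hg.cumul_sub_le hc'.1.le h.le hx
      rw [h0 c le_rfl, sub_zero] at h1
      change A.cumul g x ≤ g x * _ at h1
      rw [hgx] at h1
      have h2 := A.F₁_strictMonoOn (Ioc_subset_Icc_self hc') (Ioc_subset_Icc_self hx) h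
      have h3 := A.F₁_le_one (Ioc_subset_Icc_self hx)
      have h4 : A.cumul g x / A.F₁ x ≤ A.b₂ * (1 - A.F₁ c) / A.F₁ c := by
        refine div_le_div₀ (mul_nonneg hb.le (by linarith)) ?_ (A.F₁_pos hc') h2.le
        nlinarith
      linarith
  rw [A.objective_eq]
  refine lt_of_lt_of_le ?_ (integral_mono_ae ((integrable_const m).indicator measurableSet_Ioc)
    hg.integrable_objective_integrand hle)
  rw [integral_indicator_const _ measurableSet_Ioc, A.leaderLaw_real_Ioc hc'.1.le hc'.2 le_rfl,
    smul_eq_mul]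
  exact mul_pos (sub_pos.2 (A.F₁_strictMonoOn (Ioc_subset_Icc_self hc')
    (right_mem_Icc.2 A.a₁_lt_a₂.le) hc.2)) hpos

lemma F₂_eq_zero {y : ℝ} (hy : y ≤ A.b₁) : A.F₂ y = 0 := by
  rw [A.F₂_eq (hy.trans A.b₁_lt_b₂.le), max_eq_left (by linarith), zero_div]

lemma F₂_pos {y : ℝ} (hy : A.b₁ < y) (hy2 : y ≤ A.b₂) : 0 < A.F₂ y := by
  rw [A.F₂_eq hy2]
  exact div_pos (lt_max_of_lt_right (by linarith)) (sub_pos.2 A.b₁_lt_b₂)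

/-- A maximizer vanishes where the leader is certain to lose. -/
lemma IsMaximizer.eq_zero_of_le {g : ℝ → ℝ} (hg : A.IsMaximizer g) {w : ℝ}
    (hw : w ∈ Ioc A.a₁ A.a₂) (hgw : g w ≤ A.b₁) : g w = 0 := by
  classical
  obtain ⟨c, hc, hiff⟩ := hg.1.exists_le_iff A.b₁
  have hh := (isAdmissible_const (left_mem_Icc.2 A.b₂_pos.le)).ite_le (c := c) hg.1
    fun _ _ y hy _ _ => (hg.1.2.2 y hy).1
  -- Lowering `g` to `0` where it is at most `b₁` keeps every winning probability and lowers the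
  -- bids. Maximality forbids a gain, so the bids agree almost everywhere that the leader wins with
  -- positive probability.
  set h : ℝ → ℝ := fun x => if x ≤ c then 0 else g x with hdef
  have hle : ∀ x ∈ Ioc A.a₁ A.a₂, h x ≤ g x := fun x hx => by
    by_cases hxc : x ≤ c
    · simpa [hdef, hxc] using (hg.1.2.2 x hx).1
    · simp [hdef, hxc]
  have hF : ∀ x ∈ Ioc A.a₁ A.a₂, A.F₂ (h x) = A.F₂ (g x) := fun x hx => by
    by_cases hxc : x ≤ c
    · rw [F₂_eq_zero ((hiff x hx).2 hxc), F₂_eq_zero]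
      simpa [hdef, hxc] using A.b₁_nonneg
    · simp [hdef, hxc]
  -- there is a valuation at which the leader wins with positive probability
  obtain ⟨z, hz, hzg⟩ : ∃ z ∈ Ioc A.a₁ A.a₂, A.b₁ < g z := by
    by_contra! hcon
    obtain ⟨k, hk, hpos⟩ := exists_objective_pos (A := A)
    refine (hpos.trans_le (hg.2 k hk)).ne' ?_
    rw [A.objective_eq]
    refine integral_eq_zero_of_ae (A.ae_mem_Ioc.mono fun x hx => ?_)
    simp [F₂_eq_zero (hcon x hx)]
  obtain ⟨d, hd, hdz, hdg⟩ := hg.1.exists_lt hz hzg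
  have hbid : ∀ x ∈ Ioc A.a₁ A.a₂, A.cumul h x ≤ A.cumul g x := fun x hx =>
    setIntegral_mono_on hh.integrable.integrableOn hg.1.integrable.integrableOn measurableSet_Ioc
      fun t ht => hle t ⟨ht.1, ht.2.trans hx.2⟩
  have hdiff : ∀ᵐ x ∂A.leaderLaw,
      0 ≤ (x - A.bidOf h x) * A.F₂ (h x) - (x - A.bidOf g x) * A.F₂ (g x) := by
    filter_upwards [A.ae_mem_Ioc] with x hx
    rw [hF x hx, ← sub_mul, A.bidOf_eq h hx, A.bidOf_eq g hx]
    have := div_le_div_of_nonneg_right (hbid x hx) (A.F₁_pos hx).le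
    exact mul_nonneg (by linarith) (A.F₂_nonneg _)
  have hzero := (integral_eq_zero_iff_of_nonneg_ae hdiff (hh.integrable_objective_integrand.sub
    hg.1.integrable_objective_integrand)).1 (le_antisymm (by
      rw [integral_sub hh.integrable_objective_integrand hg.1.integrable_objective_integrand,
        ← A.objective_eq, ← A.objective_eq, sub_nonpos]
      exact hg.2 h hh) (integral_nonneg_of_ae hdiff))
  -- the two bids agree at some valuation between `d` and `z`
  have hposm : 0 < A.leaderLaw.real (Ioc d z) := by
    rw [A.leaderLaw_real_Ioc hd.le hdz.le hz.2, sub_pos]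
    exact A.F₁_strictMonoOn ⟨hd.le, hdz.le.trans hz.2⟩ (Ioc_subset_Icc_self hz) hdz
  obtain ⟨r, hr, hrz⟩ : ∃ r ∈ Ioc d z,
      (r - A.bidOf h r) * A.F₂ (h r) - (r - A.bidOf g r) * A.F₂ (g r) = 0 := by
    by_contra! hcon
    exact hposm.ne' ((measureReal_eq_zero_iff).2 (measure_mono_null hcon hzero))
  have hr' : r ∈ Ioc A.a₁ A.a₂ := ⟨hd.trans hr.1, hr.2.trans hz.2⟩
  have hgr : A.b₁ < g r := hdg r ⟨hr.1.le, hr.2⟩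
  have hbideq : A.bidOf g r = A.bidOf h r := by
    rw [hF r hr', ← sub_mul] at hrz
    have := (mul_eq_zero.1 hrz).resolve_right (F₂_pos hgr (hg.1.2.2 r hr').2).ne'
    linarith
  rw [A.bidOf_eq g hr', A.bidOf_eq h hr', div_left_inj' (A.F₁_pos hr').ne'] at hbideq
  have hnn : 0 ≤ᵐ[A.leaderLaw.restrict (Ioc A.a₁ r)] fun x => g x - h x :=
    (ae_restrict_mem measurableSet_Ioc).mono fun x hx =>
      sub_nonneg.2 (hle x ⟨hx.1, hx.2.trans hr'.2⟩)
  -- Equal bids at `r` mean equal integrals over `(a₁, r]`; since `h ≤ g`, the functions agree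
  -- there.
  have hae := (integral_eq_zero_iff_of_nonneg_ae hnn
    (hg.1.integrable.sub hh.integrable).integrableOn).1 (by
      rw [integral_sub hg.1.integrable.integrableOn hh.integrable.integrableOn]
      exact sub_eq_zero.2 hbideq)
  have hwc := (hiff w hw).1 hgw
  have hwr : w ≤ r := by
    by_contra! hlt
    exact hgr.not_ge ((hiff r hr').2 (hlt.le.trans hwc))
  have heq := ae_imp_eqOn hg.1 hh hr'.2 (by
    filter_upwards [(ae_restrict_iff' measurableSet_Ioc).1 hae, A.ae_mem_Ioc] with x hx hxm hxr
    exact (sub_eq_zero.1 (hx ⟨hxm.1, hxr⟩)).symm) w ⟨hw.1, hwr⟩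
  rw [← heq]
  exact if_pos hwc

/-! ### Monotonicity of the marginal -/

lemma IsAdmissible.tailWeight_sub {g : ℝ → ℝ} (hg : A.IsAdmissible g) {x y : ℝ}
    (hx : x ∈ Ioc A.a₁ A.a₂) (hxy : x ≤ y) (hy : y ≤ A.a₂) :
    A.tailWeight g x - A.tailWeight g y =
      ∫ t in Ioc x y, A.F₂ (g t) / A.F₁ t ∂A.leaderLaw := by
  have hint := integrableOn_div_F₁ hg.aemeasurable_F₂ (C := 1)
    (fun t _ => by rw [abs_of_nonneg (A.F₂_nonneg _)]; exact A.F₂_le_one _) hx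
  rw [tailWeight, tailWeight, ← Ioc_union_Ioc_eq_Ioc hxy hy, setIntegral_union
    (Set.disjoint_left.2 fun t h1 h2 => not_lt.2 h1.2 h2.1) measurableSet_Ioc
    (hint.mono_set (Ioc_subset_Ioc_right hy)) (hint.mono_set (Ioc_subset_Ioc_left hxy))]
  ring

/-- The increments of the marginal, where `b₁ ≤ g`. -/
lemma IsAdmissible.marginal_sub {g : ℝ → ℝ} (hg : A.IsAdmissible g) {x y : ℝ}
    (hx : x ∈ Ioc A.a₁ A.a₂) (hxy : x ≤ y) (hy : y ≤ A.a₂) (hb : ∀ t ∈ Ioc x y, A.b₁ ≤ g t) :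
    y - x + (A.cumul g x - A.b₁ * A.F₁ x) * (1 / A.F₁ x - 1 / A.F₁ y) ≤
        A.marginal g y - A.marginal g x ∧
      A.marginal g y - A.marginal g x ≤
        y - x + (A.cumul g y - A.b₁ * A.F₁ y) * (1 / A.F₁ x - 1 / A.F₁ y) := by
  have hy' : y ∈ Ioc A.a₁ A.a₂ := ⟨hx.1.trans_le hxy, hy⟩
  have hsub : ∀ t ∈ Ioc x y, t ∈ Ioc A.a₁ A.a₂ := fun t ht => ⟨hx.1.trans ht.1, ht.2.trans hy⟩
  have hFx := A.F₁_pos hx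
  have hFy := A.F₁_pos hy'
  have hbb := A.b₁_lt_b₂
  -- The integral on the right is then bounded by replacing `1 / F₁ t` by its values at the two
  -- ends, which takes the place of differentiation.
  have hT : (A.b₂ - A.b₁) * (A.tailWeight g x - A.tailWeight g y) =
      ∫ t in Ioc x y, (g t - A.b₁) / A.F₁ t ∂A.leaderLaw := by
    rw [hg.tailWeight_sub hx hxy hy, ← integral_const_mul]
    refine setIntegral_congr_fun measurableSet_Ioc fun t ht => ?_
    have h1 := hb t ht
    have h2 : A.b₂ - A.b₁ ≠ 0 := by linarith
    have h3 := (A.F₁_pos (hsub t ht)).ne'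
    rw [A.F₂_eq (hg.2.2 t (hsub t ht)).2, max_eq_right (sub_nonneg.2 h1)]
    field_simp
  have hD : ∫ t in Ioc x y, (g t - A.b₁) ∂A.leaderLaw =
      (A.cumul g y - A.b₁ * A.F₁ y) - (A.cumul g x - A.b₁ * A.F₁ x) := by
    rw [integral_sub hg.integrable.integrableOn (integrable_const _).integrableOn,
      ← cumul_sub hg.integrable hx.1.le hxy, setIntegral_const,
      A.leaderLaw_real_Ioc hx.1.le hxy hy, smul_eq_mul]
    ring
  have hi1 : IntegrableOn (fun t => g t - A.b₁) (Ioc x y) A.leaderLaw :=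
    (hg.integrable.sub (integrable_const _)).integrableOn
  have hi2 : IntegrableOn (fun t => (g t - A.b₁) / A.F₁ t) (Ioc x y) A.leaderLaw :=
    (integrableOn_div_F₁ (hg.aemeasurable.sub aemeasurable_const) (C := A.b₂ + A.b₁) (fun t ht => by
      have h1 := hg.2.2 t ht
      have h2 := A.b₁_nonneg
      simp only [Pi.sub_apply]
      rw [_root_.abs_le]
      constructor <;> linarith [h1.1, h1.2]) hx).mono_set (Ioc_subset_Ioc_right hy)
  have hlo : ((A.cumul g y - A.b₁ * A.F₁ y) - (A.cumul g x - A.b₁ * A.F₁ x)) / A.F₁ y ≤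
      ∫ t in Ioc x y, (g t - A.b₁) / A.F₁ t ∂A.leaderLaw := by
    rw [← hD, ← integral_div]
    refine setIntegral_mono_on (hi1.div_const _) hi2 measurableSet_Ioc fun t ht => ?_
    exact div_le_div_of_nonneg_left (sub_nonneg.2 (hb t ht)) (A.F₁_pos (hsub t ht))
      (A.F₁_strictMonoOn.monotoneOn (Ioc_subset_Icc_self (hsub t ht)) (Ioc_subset_Icc_self hy') ht.2)
  have hhi : ∫ t in Ioc x y, (g t - A.b₁) / A.F₁ t ∂A.leaderLaw ≤
      ((A.cumul g y - A.b₁ * A.F₁ y) - (A.cumul g x - A.b₁ * A.F₁ x)) / A.F₁ x := by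
    rw [← hD, ← integral_div]
    refine setIntegral_mono_on hi2 (hi1.div_const _) measurableSet_Ioc fun t ht => ?_
    exact div_le_div_of_nonneg_left (sub_nonneg.2 (hb t ht)) hFx
      (A.F₁_strictMonoOn.monotoneOn (Ioc_subset_Icc_self hx) (Ioc_subset_Icc_self (hsub t ht)) ht.1.le)
  rw [← hT] at hlo hhi
  have hex : A.bidOf g x = (A.cumul g x - A.b₁ * A.F₁ x) / A.F₁ x + A.b₁ := by
    rw [A.bidOf_eq g hx]; field_simp; ring
  have hey : A.bidOf g y = (A.cumul g y - A.b₁ * A.F₁ y) / A.F₁ y + A.b₁ := by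
    rw [A.bidOf_eq g hy']; field_simp; ring
  rw [marginal, marginal, hex, hey]
  simp only [sub_div, mul_sub, mul_one_div] at *
  constructor <;> linarith

/-- For `b₁ = 0` the coefficient `cumul g x` in the lower bound of `marginal_sub` is nonnegative, so
the increment is at least `y - x`. -/
lemma IsAdmissible.marginal_strictMonoOn {g : ℝ → ℝ} (hg : A.IsAdmissible g) (hb : A.b₁ = 0) :
    StrictMonoOn (A.marginal g) (Ioc A.a₁ A.a₂) := by
  intro x hx y hy hxy
  have h1 := (hg.marginal_sub hx hxy.le hy.2 fun t ht => by
    rw [hb]; exact (hg.2.2 t ⟨hx.1.trans ht.1, ht.2.trans hy.2⟩).1).1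
  have h2 := hg.cumul_nonneg hx.2
  have h3 := one_div_le_one_div_of_le (A.F₁_pos hx)
    (A.F₁_strictMonoOn (Ioc_subset_Icc_self hx) (Ioc_subset_Icc_self hy) hxy).le
  have h4 := mul_nonneg h2 (sub_nonneg.2 h3)
  rw [hb, zero_mul, sub_zero] at h1
  linarith

/-- The derivative of `-1 / F₁` is `f₁ / F₁ ^ 2`, whose own derivative is `-(2 * f₁ ^ 2 - F₁ * f₁')
/ F₁ ^ 3`. -/
lemma concaveOn_neg_inv_F₁ (hd : DifferentiableOn ℝ A.f₁ (Ioo A.a₁ A.a₂))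
    (hcond : ∀ t ∈ Ioo A.a₁ A.a₂, 0 ≤ 2 * A.f₁ t ^ 2 - A.F₁ t * deriv A.f₁ t) :
    ConcaveOn ℝ (Ioc A.a₁ A.a₂) fun x => -(A.F₁ x)⁻¹ := by
  have hF : ∀ x ∈ Ioo A.a₁ A.a₂, HasDerivAt A.F₁ (A.f₁ x) x := fun x hx => by
    refine intervalIntegral.integral_hasDerivAt_right
      (A.intervalIntegrable_f₁ (left_mem_Icc.2 A.a₁_lt_a₂.le) (Ioo_subset_Icc_self hx)) ?_ ?_
    · exact hd.continuousOn.stronglyMeasurableAtFilter isOpen_Ioo x hx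
    · exact (hd.differentiableAt (isOpen_Ioo.mem_nhds hx)).continuousAt
  have hpos : ∀ x ∈ Ioo A.a₁ A.a₂, A.F₁ x ≠ 0 := fun x hx =>
    (A.F₁_pos (Ioo_subset_Ioc_self hx)).ne'
  have hw : ∀ x ∈ Ioo A.a₁ A.a₂,
      HasDerivAt (fun x => -(A.F₁ x)⁻¹) (A.f₁ x / A.F₁ x ^ 2) x := fun x hx => by
    exact (((hF x hx).inv (hpos x hx)).neg).congr_deriv (by ring)
  have hw2 : ∀ x ∈ Ioo A.a₁ A.a₂, HasDerivAt (fun x => A.f₁ x / A.F₁ x ^ 2)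
      ((deriv A.f₁ x * A.F₁ x ^ 2 - A.f₁ x * (2 * A.F₁ x * A.f₁ x)) / (A.F₁ x ^ 2) ^ 2) x :=
    fun x hx => by
      exact ((hd.differentiableAt (isOpen_Ioo.mem_nhds hx)).hasDerivAt.div
        ((hF x hx).pow 2) (pow_ne_zero 2 (hpos x hx))).congr_deriv (by simp)
  have hanti : AntitoneOn (fun x => A.f₁ x / A.F₁ x ^ 2) (Ioo A.a₁ A.a₂) := by
    refine antitoneOn_of_deriv_nonpos (convex_Ioo _ _)
      (fun x hx => (hw2 x hx).continuousAt.continuousWithinAt) ?_ ?_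
    · rw [interior_Ioo]
      exact fun x hx => (hw2 x hx).differentiableAt.differentiableWithinAt
    · rw [interior_Ioo]
      intro x hx
      rw [(hw2 x hx).deriv]
      refine div_nonpos_of_nonpos_of_nonneg ?_ (by positivity)
      have h1 := A.F₁_pos (Ioo_subset_Ioc_self hx)
      have h2 := mul_nonneg h1.le (hcond x hx)
      nlinarith
  refine AntitoneOn.concaveOn_of_deriv (convex_Ioc _ _) ?_ ?_ ?_
  · exact ((A.F₁_continuousOn.mono Ioc_subset_Icc_self).inv₀ fun x hx => (A.F₁_pos hx).ne').neg
  · rw [interior_Ioc]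
    exact fun x hx => (hw x hx).differentiableAt.differentiableWithinAt
  · rw [interior_Ioc]
    exact hanti.congr fun x hx => (hw x hx).deriv.symm

/-- If `-1 / F₁` is concave, the marginal is strictly quasiconvex where `b₁ < g`. -/
lemma IsAdmissible.marginal_lt {g : ℝ → ℝ} (hg : A.IsAdmissible g)
    (hconc : ConcaveOn ℝ (Ioc A.a₁ A.a₂) fun x => -(A.F₁ x)⁻¹) {x y z : ℝ}
    (hx : x ∈ Ioc A.a₁ A.a₂) (hz : z ∈ Ioc A.a₁ A.a₂) (hxy : x < y) (hyz : y < z)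
    (hb : A.b₁ < g x) (hle : A.marginal g x ≤ A.marginal g y) :
    A.marginal g y < A.marginal g z := by
  set w : ℝ → ℝ := fun x => -(A.F₁ x)⁻¹ with hw
  have hgb : ∀ t ∈ Ioc A.a₁ A.a₂, x ≤ t → A.b₁ < g t := fun t ht h => hb.trans_le (hg.1 hx ht h)
  -- The auxiliary point `m` yields strictness: the marginal does not decrease on `[y, m]`, and the
  -- strict growth of `cumul g - b₁ * F₁` up to `m` gives a strict increase on `[m, z]`.
  set m := (y + z) / 2 with hm
  have hym : y < m := by linarith
  have hmz : m < z := by linarith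
  have hy' : y ∈ Ioc A.a₁ A.a₂ := ⟨hx.1.trans hxy, hyz.le.trans hz.2⟩
  have hm' : m ∈ Ioc A.a₁ A.a₂ := ⟨hy'.1.trans hym, hmz.le.trans hz.2⟩
  have hinc : ∀ s ∈ Ioc A.a₁ A.a₂, ∀ t ∈ Ioc A.a₁ A.a₂, s < t →
      1 / A.F₁ s - 1 / A.F₁ t = w t - w s ∧ 0 < w t - w s := fun s hs t ht hst => by
    have h1 := one_div_lt_one_div_of_lt (A.F₁_pos hs)
      (A.F₁_strictMonoOn (Ioc_subset_Icc_self hs) (Ioc_subset_Icc_self ht) hst)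
    have h2 : 1 / A.F₁ s - 1 / A.F₁ t = w t - w s := by simp only [hw, one_div]; ring
    exact ⟨h2, by linarith⟩
  have hsub : ∀ s ∈ Ioc A.a₁ A.a₂, ∀ t ∈ Ioc A.a₁ A.a₂, x ≤ s → s < t →
      t - s + (A.cumul g s - A.b₁ * A.F₁ s) * (w t - w s) ≤ A.marginal g t - A.marginal g s ∧
      A.marginal g t - A.marginal g s ≤ t - s + (A.cumul g t - A.b₁ * A.F₁ t) * (w t - w s) :=
    fun s hs t ht hxs hst => by
      have := hg.marginal_sub hs hst.le ht.2 fun r hr =>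
        (hgb r ⟨hs.1.trans hr.1, hr.2.trans ht.2⟩ (hxs.trans hr.1.le)).le
      rwa [(hinc s hs t ht hst).1] at this
  have h1 := (hsub x hx y hy' le_rfl hxy).2
  have h2 := (hsub y hy' m hm' hxy.le hym).1
  have h3 := (hsub m hm' z hz (hxy.trans hym).le hmz).1
  have p1 := (hinc x hx y hy' hxy).2
  have p2 := (hinc y hy' m hm' hym).2
  have p3 := (hinc m hm' z hz hmz).2
  have s1 : (w m - w y) / (m - y) ≤ (w y - w x) / (y - x) := hconc.slope_anti_adjacent hx hm' hxy hym
  have s2 : (w z - w m) / (z - m) ≤ (w m - w y) / (m - y) :=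
    hconc.slope_anti_adjacent hy' hz hym hmz
  set p := (w y - w x) / (y - x) with hp
  have hp0 : 0 < p := div_pos p1 (by linarith)
  have e1 : w y - w x = p * (y - x) := by rw [hp, div_mul_cancel₀ _ (by linarith)]
  have e2 : w m - w y ≤ p * (m - y) := (div_le_iff₀ (by linarith)).1 s1
  have e3 : w z - w m ≤ p * (z - m) := (div_le_iff₀ (by linarith)).1 (s2.trans s1)
  have hΔ : A.cumul g y - A.b₁ * A.F₁ y < A.cumul g m - A.b₁ * A.F₁ m := by
    have h4 := hg.le_cumul_sub hy' hym.le hm'.2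
    have h5 := A.F₁_strictMonoOn (Ioc_subset_Icc_self hy') (Ioc_subset_Icc_self hm') hym
    have h6 := hgb y hy' hxy.le
    nlinarith
  set Δy := A.cumul g y - A.b₁ * A.F₁ y with hΔy
  set Δm := A.cumul g m - A.b₁ * A.F₁ m with hΔm
  -- Since `E x ≤ E y` for the marginal `E`, the upper bound on its increment over `[x, y]` is
  -- nonnegative. To the right, slopes of `-1 / F₁` are at most `p` by concavity, so a negative
  -- coefficient of them costs no more than at slope `p`.
  have hq : 0 ≤ 1 + Δy * p := by
    have : 0 ≤ (y - x) * (1 + Δy * p) := by rw [e1] at h1; linarith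
    exact nonneg_of_mul_nonneg_right this (by linarith)
  have hstep1 : A.marginal g y ≤ A.marginal g m := by
    rcases le_or_gt 0 Δy with h | h
    · nlinarith
    · have : Δy * (p * (m - y)) ≤ Δy * (w m - w y) := mul_le_mul_of_nonpos_left e2 h.le
      have : 0 ≤ (m - y) * (1 + Δy * p) := mul_nonneg (by linarith) hq
      linarith
  have hstep2 : A.marginal g m < A.marginal g z := by
    rcases le_or_gt 0 Δm with h | h
    · nlinarith
    · have : Δm * (p * (z - m)) ≤ Δm * (w z - w m) := mul_le_mul_of_nonpos_left e3 h.le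
      have : Δy * p < Δm * p := mul_lt_mul_of_pos_right hΔ hp0
      have : 0 < (z - m) * (1 + Δm * p) := mul_pos (by linarith) (by linarith)
      linarith
  exact hstep1.trans_lt hstep2

/-! ### ### At most three values -/

/-- A strictly quasiconvex function vanishes at most twice. -/
lemma countable_zeros_of_quasiconvex {E : ℝ → ℝ} {S : Set ℝ}
    (hE : ∀ x ∈ S, ∀ y ∈ S, ∀ z ∈ S, x < y → y < z → E x ≤ E y → E y < E z) :
    {x ∈ S | E x = 0}.Countable := by
  rcases Set.subsingleton_or_nontrivial {x ∈ S | E x = 0} with h | h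
  · exact h.countable
  obtain ⟨x, hx, y, hy, hxy⟩ := h.exists_lt
  refine (Set.toFinite {x, y}).countable.mono fun z hz => ?_
  by_contra hne
  simp only [mem_insert_iff, mem_singleton_iff, not_or] at hne
  rcases lt_or_gt_of_ne hne.1 with h1 | h1
  · have := hE z hz.1 x hx.1 y hy.1 h1 hxy (by rw [hz.2, hx.2])
    rw [hx.2, hy.2] at this
    exact lt_irrefl _ this
  rcases lt_or_gt_of_ne hne.2 with h2 | h2
  · have := hE x hx.1 z hz.1 y hy.1 h1 h2 (by rw [hz.2, hx.2])
    rw [hz.2, hy.2] at this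
    exact lt_irrefl _ this
  · have := hE x hx.1 y hy.1 z hz.1 hxy h2 (by rw [hx.2, hy.2])
    rw [hy.2, hz.2] at this
    exact lt_irrefl _ this

lemma ae_notMem_of_countable {S : Set ℝ} (hS : S.Countable) : ∀ᵐ x ∂A.leaderLaw, x ∉ S :=
  compl_mem_ae_iff.2 (hS.measure_zero _)

/-- Let `N` be the set where `g > b₁` and the marginal is negative. The competitor keeps `g` where
`g ≤ b₁`, takes the infimum of `g` over `N` as its constant value up to `sup N`, and is `b₂` beyond.
Each change has the sign of the marginal, so a maximizer equals this competitor. -/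
theorem IsMaximizer.encard_image_le {g : ℝ → ℝ} (hg : A.IsMaximizer g)
    (hconc : ConcaveOn ℝ (Ioc A.a₁ A.a₂) fun x => -(A.F₁ x)⁻¹) :
    (g '' Ioc A.a₁ A.a₂).encard ≤ 3 := by
  classical
  obtain ⟨c, hc, hiff⟩ := hg.1.exists_le_iff A.b₁
  have hgt : ∀ x ∈ Ioc A.a₁ A.a₂, c < x → A.b₁ < g x := fun x hx hcx => by
    by_contra! h
    exact hcx.not_ge ((hiff x hx).1 h)
  set S := Ioc c A.a₂ with hS
  have hSsub : ∀ x ∈ S, x ∈ Ioc A.a₁ A.a₂ := fun x hx => ⟨hc.1.trans_lt hx.1, hx.2⟩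
  have hE : ∀ x ∈ S, ∀ y ∈ S, ∀ z ∈ S, x < y → y < z →
      A.marginal g x ≤ A.marginal g y → A.marginal g y < A.marginal g z :=
    fun x hx y _ z hz hxy hyz h =>
      hg.1.marginal_lt hconc (hSsub x hx) (hSsub z hz) hxy hyz (hgt x (hSsub x hx) hx.1) h
  set N := {x ∈ S | A.marginal g x < 0} with hN
  have hNb : BddAbove N := ⟨A.a₂, fun x hx => hx.1.2⟩
  have hNg : BddBelow (g '' N) := ⟨0, by
    rintro _ ⟨x, hx, rfl⟩; exact (hg.1.2.2 x (hSsub x hx.1)).1⟩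
  -- the middle value `v`, taken up to `β`
  obtain ⟨v, β, hv, hcβ, hlow, hmid⟩ : ∃ v β : ℝ, v ∈ Icc A.b₁ A.b₂ ∧ c ≤ β ∧
      (∀ x ∈ N, x ≤ β ∧ v ≤ g x) ∧ (∀ x ∈ S, x ∉ N → x < β → g x ≤ v) := by
    rcases N.eq_empty_or_nonempty with h | ⟨n, hn⟩
    -- If the marginal is never negative, the middle piece is empty (`β = c`) and `v` is arbitrary.
    · exact ⟨A.b₂, c, ⟨A.b₁_lt_b₂.le, le_rfl⟩, le_rfl, by simp [h],
        fun x hx _ hxc => absurd hx.1 hxc.not_gt⟩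
    · refine ⟨sInf (g '' N), sSup N, ⟨le_csInf ⟨_, n, hn, rfl⟩ ?_, ?_⟩,
        hn.1.1.le.trans (le_csSup hNb hn), fun x hx => ⟨le_csSup hNb hx, csInf_le hNg ⟨x, hx, rfl⟩⟩,
        fun x hx hxN hxβ => le_csInf ⟨_, n, hn, rfl⟩ ?_⟩
      · rintro _ ⟨x, hx, rfl⟩
        exact (hgt x (hSsub x hx.1) hx.1.1).le
      · exact (csInf_le hNg ⟨n, hn, rfl⟩).trans (hg.1.2.2 n (hSsub n hn.1)).2
      · rintro _ ⟨y, hy, rfl⟩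
        refine hg.1.1 (hSsub x hx) (hSsub y hy.1) ?_
        by_contra! hyx
        obtain ⟨z, hz, hxz⟩ := exists_lt_of_lt_csSup ⟨n, hn⟩ hxβ
        have hx0 : 0 ≤ A.marginal g x := not_lt.1 fun h => hxN ⟨hx, h⟩
        -- A point of nonnegative marginal between two points of `N` would contradict
        -- quasiconvexity, so points before `β` outside `N` lie to the left of all of `N`.
        have := hE y hy.1 x hx z hz.1 hyx hxz (hy.2.le.trans hx0)
        exact (hx0.trans_lt this).not_gt hz.2
  have hv0 : v ∈ Icc 0 A.b₂ := ⟨A.b₁_nonneg.trans hv.1, hv.2⟩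
  have hstep := (isAdmissible_const hv0).ite_le (c := β)
    (isAdmissible_const (right_mem_Icc.2 A.b₂_pos.le)) fun _ _ _ _ _ _ => hv0.2
  have hh := hg.1.ite_le (c := c) hstep fun x hx y hy hxc _ => by
    have h1 := (hiff x hx).2 hxc
    split_ifs
    · exact h1.trans hv.1
    · exact (hg.1.2.2 x hx).2
  set h : ℝ → ℝ := fun x => if x ≤ c then g x else if x ≤ β then v else A.b₂ with hdef
  have hlo : ∀ x ≤ c, h x = g x := fun x hx => by simp [hdef, hx]
  have hmi : ∀ x, c < x → x ≤ β → h x = v := fun x h1 h2 => by simp [hdef, h1.not_ge, h2]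
  have hhi : ∀ x, β < x → h x = A.b₂ := fun x h1 => by
    simp [hdef, (hcβ.trans_lt h1).not_ge, h1.not_ge]
  have heq : ∀ x ∈ Ioc A.a₁ A.a₂, h x = g x := by
    refine hg.eq_of_marginal hh (fun x hx => ?_) ?_ ?_
    · rcases le_or_gt x c with hxc | hxc
      · exact Or.inl (hlo x hxc)
      · refine Or.inr ⟨(hgt x hx hxc).le, ?_⟩
        rcases le_or_gt x β with hxβ | hxβ
        · rw [hmi x hxc hxβ]; exact hv.1
        · rw [hhi x hxβ]; exact A.b₁_lt_b₂.le
    · filter_upwards [A.ae_mem_Ioc, ae_notMem_of_countable (countable_singleton β)] with x hx hxβ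
      rcases le_or_gt x c with hxc | hxc
      · rw [hlo x hxc]; simp
      have hxS : x ∈ S := ⟨hxc, hx.2⟩
      by_cases hxN : x ∈ N
      · obtain ⟨h1, h2⟩ := hlow x hxN
        rw [hmi x hxc h1]
        exact mul_nonneg_of_nonpos_of_nonpos (by linarith) hxN.2.le
      · have hx0 : 0 ≤ A.marginal g x := not_lt.1 fun h => hxN ⟨hxS, h⟩
        refine mul_nonneg (sub_nonneg.2 ?_) hx0
        rcases lt_or_gt_of_ne (show x ≠ β from hxβ) with hlt | hlt
        · rw [hmi x hxc hlt.le]; exact hmid x hxS hxN hlt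
        · rw [hhi x hlt]; exact (hg.1.2.2 x hx).2
    · filter_upwards [A.ae_mem_Ioc, ae_notMem_of_countable (countable_zeros_of_quasiconvex hE)]
        with x hx hxz hne h0
      have hxc : c < x := by
        by_contra! hxc
        exact hne (hlo x hxc)
      exact hxz ⟨⟨hxc, hx.2⟩, h0⟩
  have hsub : g '' Ioc A.a₁ A.a₂ ⊆ {0, v, A.b₂} := by
    rintro _ ⟨x, hx, rfl⟩
    rcases le_or_gt x c with hxc | hxc
    · exact Or.inl (hg.eq_zero_of_le hx ((hiff x hx).2 hxc))
    · rw [← heq x hx]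
      rcases le_or_gt x β with hxβ | hxβ
      · rw [hmi x hxc hxβ]; simp
      · rw [hhi x hxβ]; simp
  refine (encard_le_encard hsub).trans ?_
  have h1 := encard_insert_le ({v, A.b₂} : Set ℝ) 0
  have h2 := encard_insert_le ({A.b₂} : Set ℝ) v
  rw [encard_singleton] at h2
  exact h1.trans ((add_le_add_left h2 1).trans (by norm_num))

/-! ### ### The threshold for `b₁ = 0` -/

/-- If `b₁ = 0`, a maximizer jumps from `0` to `b₂` where the marginal changes sign. -/
lemma IsMaximizer.exists_threshold {g : ℝ → ℝ} (hg : A.IsMaximizer g) (hb : A.b₁ = 0) :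
    ∃ β ∈ Icc A.a₁ A.a₂, (∀ x ∈ Ioc A.a₁ A.a₂, x ≤ β → g x = 0) ∧
      (∀ x ∈ Ioc A.a₁ A.a₂, β < x → g x = A.b₂) ∧
      (∀ x ∈ Ioc A.a₁ A.a₂, x < β → A.marginal g x < 0) ∧
      (∀ x ∈ Ioc A.a₁ A.a₂, β < x → 0 ≤ A.marginal g x) := by
  classical
  have hE := hg.1.marginal_strictMonoOn hb
  set N := insert A.a₁ {x ∈ Ioc A.a₁ A.a₂ | A.marginal g x < 0} with hN
  have hub : ∀ x ∈ N, x ≤ A.a₂ := by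
    rintro x (rfl | hx)
    · exact A.a₁_lt_a₂.le
    · exact hx.1.2
  have hbdd : BddAbove N := ⟨A.a₂, hub⟩
  have ha : A.a₁ ∈ N := mem_insert _ _
  set β := sSup N with hβ
  have hneg : ∀ x ∈ Ioc A.a₁ A.a₂, x < β → A.marginal g x < 0 := fun x hx hxβ => by
    obtain ⟨z, hz, hxz⟩ := exists_lt_of_lt_csSup ⟨_, ha⟩ hxβ
    rcases hz with rfl | hz
    · exact absurd hx.1 hxz.not_gt
    · exact (hE hx hz.1 hxz).trans hz.2
  have hpos : ∀ x ∈ Ioc A.a₁ A.a₂, β < x → 0 ≤ A.marginal g x := fun x hx hxβ => by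
    by_contra! h
    exact hxβ.not_ge (le_csSup hbdd (mem_insert_of_mem _ ⟨hx, h⟩))
  have hb2 := A.b₂_pos.le
  have hh := (isAdmissible_const (left_mem_Icc.2 hb2)).ite_le (c := β)
    (isAdmissible_const (A := A) (right_mem_Icc.2 hb2)) fun _ _ _ _ _ _ => hb2
  have heq := hg.eq_of_marginal hh (fun x hx => Or.inr (by
      rw [hb]; exact ⟨(hg.1.2.2 x hx).1, (hh.2.2 x hx).1⟩)) (by
    filter_upwards [A.ae_mem_Ioc, ae_notMem_of_countable (countable_singleton β)] with x hx hxβ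
    rcases lt_or_gt_of_ne (show x ≠ β from hxβ) with h | h
    · rw [if_pos h.le]
      exact mul_nonneg_of_nonpos_of_nonpos (by linarith [(hg.1.2.2 x hx).1]) (hneg x hx h).le
    · rw [if_neg h.not_ge]
      exact mul_nonneg (by linarith [(hg.1.2.2 x hx).2]) (hpos x hx h)) (by
    have hq := countable_zeros_of_quasiconvex (E := A.marginal g) (S := Ioc A.a₁ A.a₂)
      fun x _ y hy z hz _ hyz _ => hE hy hz hyz
    filter_upwards [A.ae_mem_Ioc, ae_notMem_of_countable hq] with x hx hxz _ h0
    exact hxz ⟨hx, h0⟩)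
  refine ⟨β, ⟨le_csSup hbdd ha, csSup_le ⟨_, ha⟩ hub⟩, fun x hx hxβ => ?_, fun x hx hxβ => ?_,
    hneg, hpos⟩
  · rw [← heq x hx, if_pos hxβ]
  · rw [← heq x hx, if_neg hxβ.not_ge]

lemma integral_density_div {t : ℝ} (ht : t ∈ Icc A.a₁ A.a₂) :
    ∫ x in t..A.a₂, A.f₁ x / A.F₁ x = ∫ x in Ioc t A.a₂, 1 / A.F₁ x ∂A.leaderLaw := by
  rw [A.setIntegral_leaderLaw _ ht.1 ht.2 le_rfl]
  simp only [mul_one_div]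

lemma setIntegral_one_div_F₁_sub {x y : ℝ} (hx : x ∈ Ioc A.a₁ A.a₂) (hxy : x ≤ y) (hy : y ≤ A.a₂) :
    0 ≤ ∫ t in Ioc x A.a₂, 1 / A.F₁ t ∂A.leaderLaw - ∫ t in Ioc y A.a₂, 1 / A.F₁ t ∂A.leaderLaw ∧
    ∫ t in Ioc x A.a₂, 1 / A.F₁ t ∂A.leaderLaw - ∫ t in Ioc y A.a₂, 1 / A.F₁ t ∂A.leaderLaw ≤
      (A.F₁ y - A.F₁ x) / A.F₁ x := by
  have hsub : ∀ t ∈ Ioc x y, t ∈ Ioc A.a₁ A.a₂ := fun t ht => ⟨hx.1.trans ht.1, ht.2.trans hy⟩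
  have hint := integrableOn_div_F₁ (A := A) (k := fun _ => 1) aemeasurable_const (C := 1)
    (fun t _ => by simp) hx
  have hint' := hint.mono_set (Ioc_subset_Ioc_right hy)
  have hsplit : ∫ t in Ioc x A.a₂, 1 / A.F₁ t ∂A.leaderLaw -
      ∫ t in Ioc y A.a₂, 1 / A.F₁ t ∂A.leaderLaw = ∫ t in Ioc x y, 1 / A.F₁ t ∂A.leaderLaw := by
    rw [← Ioc_union_Ioc_eq_Ioc hxy hy, setIntegral_union
      (Set.disjoint_left.2 fun t h1 h2 => not_lt.2 h1.2 h2.1) measurableSet_Ioc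
      hint' (hint.mono_set (Ioc_subset_Ioc_left hxy))]
    ring
  rw [hsplit]
  refine ⟨setIntegral_nonneg measurableSet_Ioc fun t ht =>
    one_div_nonneg.2 (A.F₁_pos (hsub t ht)).le, ?_⟩
  have := setIntegral_mono_on hint' (integrable_const (1 / A.F₁ x)).integrableOn measurableSet_Ioc
    fun t ht => one_div_le_one_div_of_le (A.F₁_pos hx) (A.F₁_strictMonoOn.monotoneOn
      (Ioc_subset_Icc_self hx) (Ioc_subset_Icc_self (hsub t ht)) ht.1.le)
  rwa [setIntegral_const, A.leaderLaw_real_Ioc hx.1.le hxy hy, smul_eq_mul, mul_one_div] at this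

/-- For a step at `β`, the marginal has an explicit form on each side. An interior `β` must solve
the threshold equation, by limits from both sides; a solution on either side of `β` contradicts the
sign of the marginal or of its limit. -/
theorem IsMaximizer.eq_step {g : ℝ → ℝ} (hg : A.IsMaximizer g) (hb : A.b₁ = 0) :
    (∀ t₀ ∈ Ioo A.a₁ A.a₂, t₀ = A.b₂ * ∫ t in t₀..A.a₂, A.f₁ t / A.F₁ t →
      (∀ x ∈ Ioc A.a₁ t₀, g x = 0) ∧ (∀ x ∈ Ioc t₀ A.a₂, g x = A.b₂)) ∧
    ((¬ ∃ t₀ ∈ Ioo A.a₁ A.a₂, t₀ = A.b₂ * ∫ t in t₀..A.a₂, A.f₁ t / A.F₁ t) →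
      ∀ x ∈ Ioc A.a₁ A.a₂, g x = A.b₂) := by
  obtain ⟨β, hβ, hzero, htop, hneg, hpos⟩ := hg.exists_threshold hb
  have hb2 := A.b₂_pos
  set W : ℝ → ℝ := fun t => ∫ x in Ioc t A.a₂, 1 / A.F₁ x ∂A.leaderLaw with hW
  have hWF : ∀ t ∈ Icc A.a₁ A.a₂, ∫ x in t..A.a₂, A.f₁ x / A.F₁ x = W t :=
    fun t ht => integral_density_div ht
  have hF20 : A.F₂ 0 = 0 := F₂_eq_zero hb.ge
  have hF2b : A.F₂ A.b₂ = 1 := by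
    rw [A.F₂_eq le_rfl, hb, sub_zero, max_eq_right hb2.le, div_self hb2.ne']
  have hWtail : ∀ x, β ≤ x → A.tailWeight g x = W x := fun x hx =>
    setIntegral_congr_fun measurableSet_Ioc fun t ht => by
      have ht' : β < t := hx.trans_lt ht.1
      simp only [htop t ⟨hβ.1.trans_lt ht', ht.2⟩ ht', hF2b]
  have hcum : ∀ x ∈ Icc A.a₁ β, A.cumul g x = 0 := fun x hx => by
    rw [cumul, setIntegral_congr_fun (g := fun _ => 0) measurableSet_Ioc fun t ht =>
      hzero t ⟨ht.1, (ht.2.trans hx.2).trans hβ.2⟩ (ht.2.trans hx.2)]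
    simp
  have hbelow : ∀ x ∈ Ioc A.a₁ A.a₂, x < β → x - A.b₂ * W β < 0 := fun x hx hxβ => by
    have h1 := hneg x hx hxβ
    have h2 : A.tailWeight g x = W β := by
      rw [← hWtail β le_rfl, ← sub_eq_zero, hg.1.tailWeight_sub hx hxβ.le hβ.2,
        setIntegral_congr_fun (g := fun _ => 0) measurableSet_Ioc fun t ht => by
          simp only [hzero t ⟨hx.1.trans ht.1, ht.2.trans hβ.2⟩ ht.2, hF20, zero_div]]
      simp
    rw [marginal, A.bidOf_eq g hx, hcum x ⟨hx.1.le, hxβ.le⟩, h2, hb] at h1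
    simpa using h1
  have habove : ∀ x ∈ Ioc A.a₁ A.a₂, β < x →
      0 ≤ x - A.b₂ * ((A.F₁ x - A.F₁ β) / A.F₁ x) - A.b₂ * W x := fun x hx hxβ => by
    have h1 := hpos x hx hxβ
    have h2 : A.cumul g x = A.b₂ * (A.F₁ x - A.F₁ β) := by
      rw [← sub_zero (A.cumul g x), ← hcum β ⟨hβ.1, le_rfl⟩, cumul_sub hg.1.integrable hβ.1 hxβ.le,
        setIntegral_congr_fun (g := fun _ => A.b₂) measurableSet_Ioc fun t ht =>
          htop t ⟨hβ.1.trans_lt ht.1, ht.2.trans hx.2⟩ ht.1,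
        setIntegral_const, A.leaderLaw_real_Ioc hβ.1 hxβ.le hx.2, smul_eq_mul, mul_comm]
    rw [marginal, A.bidOf_eq g hx, h2, hWtail x hxβ.le, hb, sub_zero, mul_div_assoc] at h1
    exact h1
  -- Limit of `hbelow` as `x` increases to `β`. If `β = a₁` there are no valuations below `β` to
  -- use.
  have hle : A.a₁ < β → β ≤ A.b₂ * W β := fun hβ1 => by
    refine le_of_forall_lt fun y hy => ?_
    have h1 : max y ((A.a₁ + β) / 2) < β := max_lt hy (by linarith)
    have h2 : A.a₁ < max y ((A.a₁ + β) / 2) := lt_max_of_lt_right (by linarith)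
    have := hbelow _ ⟨h2, h1.le.trans hβ.2⟩ h1
    linarith [le_max_left y ((A.a₁ + β) / 2)]
  constructor
  · intro t₀ ht₀ heq
    rw [hWF t₀ (Ioo_subset_Icc_self ht₀)] at heq
    have ht₀' := Ioo_subset_Ioc_self ht₀
    have hβt : β = t₀ := by
      rcases lt_trichotomy β t₀ with h | h | h
      · have h1 := habove t₀ ht₀' h
        have h2 := div_pos (sub_pos.2 (A.F₁_strictMonoOn hβ (Ioo_subset_Icc_self ht₀) h))
          (A.F₁_pos ht₀')
        nlinarith
      · exact h
      · have h1 := hle (ht₀.1.trans h)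
        have h2 : 0 ≤ W t₀ - W β := (setIntegral_one_div_F₁_sub ht₀' h.le hβ.2).1
        nlinarith
    subst hβt
    exact ⟨fun x hx => hzero x ⟨hx.1, hx.2.trans hβ.2⟩ hx.2,
      fun x hx => htop x ⟨hβ.1.trans_lt hx.1, hx.2⟩ hx.1⟩
  · intro hno
    suffices hβa : β = A.a₁ from fun x hx => htop x hx (hβa ▸ hx.1)
    by_contra hne
    have hβ1 : A.a₁ < β := lt_of_le_of_ne hβ.1 (Ne.symm hne)
    have hβ' : β ∈ Ioc A.a₁ A.a₂ := ⟨hβ1, hβ.2⟩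
    have hle := hle hβ1
    -- At `β = a₂` the tail integral vanishes, and `hle` would give `a₂ ≤ 0`.
    have hβ2 : β < A.a₂ := by
      refine lt_of_le_of_ne hβ.2 fun h => ?_
      rw [h, hW] at hle
      simp only [Ioc_self, setIntegral_empty, mul_zero] at hle
      exact (A.a₁_nonneg.trans_lt A.a₁_lt_a₂).not_ge hle
    refine hno ⟨β, ⟨hβ1, hβ2⟩, ?_⟩
    rw [hWF β hβ]
    refine le_antisymm hle ?_
    have hF : Tendsto A.F₁ (𝓝[>] β) (𝓝 (A.F₁ β)) :=
      ((A.F₁_continuousOn β hβ).mono_left (nhdsWithin_le_iff.2 (mem_of_superset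
        (Ioo_mem_nhdsGT hβ2) fun t ht => ⟨hβ.1.trans ht.1.le, ht.2.le⟩)))
    have hid : Tendsto (fun x : ℝ => x) (𝓝[>] β) (𝓝 β) := nhdsWithin_le_nhds
    -- This function bounds `b₂ * W β` from above for `x > β`: `habove` controls `W x`, and `W β - W
    -- x` is at most `(F₁ x - F₁ β) / F₁ β`.
    have hlim := hid.add (((hF.sub (tendsto_const_nhds (x := A.F₁ β))).div_const
      (A.F₁ β)).const_mul A.b₂)
    simp only [sub_self, zero_div, mul_zero, add_zero] at hlim
    refine ge_of_tendsto hlim ?_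
    filter_upwards [Ioo_mem_nhdsGT hβ2] with x hx
    have hx' : x ∈ Ioc A.a₁ A.a₂ := ⟨hβ1.trans hx.1, hx.2.le⟩
    have h1 := habove x hx' hx.1
    have h2 := (setIntegral_one_div_F₁_sub hβ' hx.1.le hx.2.le).2
    have h3 := div_pos (sub_pos.2 (A.F₁_strictMonoOn hβ (Ioc_subset_Icc_self hx') hx.1))
      (A.F₁_pos hx')
    change W β - W x ≤ _ at h2
    nlinarith

end FirstPriceAuction

/-! ### ### The main theorem -/

theorem mainTheorem8 (A : FirstPriceAuction) :
    -- the optimal `g`: it exists, and it is the same in the auction and in the problem for `g`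
    (∃ g : ℝ → ℝ, A.IsOptimalEqualBid g) ∧
    (∀ g : ℝ → ℝ, A.IsOptimalEqualBid g ↔ A.IsMaximizer g) ∧
    -- (1)
    (DifferentiableOn ℝ A.f₁ (Ioo A.a₁ A.a₂) →
      (∀ t ∈ Ioo A.a₁ A.a₂, 0 ≤ 2 * A.f₁ t ^ 2 - A.F₁ t * deriv A.f₁ t) →
      ∀ g : ℝ → ℝ, A.IsOptimalEqualBid g → (g '' Ioc A.a₁ A.a₂).encard ≤ 3) ∧
    -- (2)
    (A.b₁ = 0 → ∀ g : ℝ → ℝ, A.IsOptimalEqualBid g →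
      (∀ t₀ ∈ Ioo A.a₁ A.a₂, t₀ = A.b₂ * ∫ t in t₀..A.a₂, A.f₁ t / A.F₁ t →
        (∀ x ∈ Ioc A.a₁ t₀, g x = 0) ∧ (∀ x ∈ Ioc t₀ A.a₂, g x = A.b₂)) ∧
      ((¬ ∃ t₀ ∈ Ioo A.a₁ A.a₂, t₀ = A.b₂ * ∫ t in t₀..A.a₂, A.f₁ t / A.F₁ t) →
        ∀ x ∈ Ioc A.a₁ A.a₂, g x = A.b₂)) := by
  refine ⟨?_, FirstPriceAuction.isOptimalEqualBid_iff, fun hd hcond g hg => ?_, fun hb g hg => ?_⟩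
  · obtain ⟨g, hg⟩ := FirstPriceAuction.exists_isMaximizer (A := A)
    exact ⟨g, (FirstPriceAuction.isOptimalEqualBid_iff g).2 hg⟩
  · exact ((FirstPriceAuction.isOptimalEqualBid_iff g).1 hg).encard_image_le
      (FirstPriceAuction.concaveOn_neg_inv_F₁ hd hcond)
  · exact ((FirstPriceAuction.isOptimalEqualBid_iff g).1 hg).eq_step hb
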